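/- Fix an integer $d\ge 1$, and write $\mathcal D(\Omega)$, $\mathcal D'(\Omega)$, $\mathcal E(\Omega)$ for the complex test functions, distributions and smooth functions on an open set $\Omega\subseteq\mathbb R^d$. **Directing sets.** For $\varphi\in\mathcal D_0:=\mathcal D(\mathbb R^d)$ let $R_\varphi=\sup\{\|x\|:\varphi(x)\ne0\}$ if $\varphi\neq0$, and $R_0=1$. For $n\ge1$ let $\mathcal D_n$ be the set of $\varphi\in\mathcal D_0$ that are real-valued and even and satisfy $R_\varphi\le 1/n$; $\int\varphi=1$; $\int x^\alpha\varphi(x)\,dx=0$ for $1\le|\alpha|\le n$; $\int|\varphi|\le 1+1/n$; and $\sup|\partial^\alpha\varphi|\le R_\varphi^{-2(|\alpha|+d)}$ for $|\alpha|\le n$. Let $\mathcal U$ be an ultrafilter on $\mathcal D_0$ with $\mathcal D_n\in\mathcal U$ for all $n\ge 0$; "a.e." means "for all $\varphi$ in some member of $\mathcal U$". **Asymptotic numbers.** A net $(A_\varphi)\in\mathbb C^{\mathcal D_0}$ is moderate if $|A_\varphi|\le R_\varphi^{-m}$ a.e. for some $m\in\mathbb N$, and negligible if $|A_\varphi|<R_\varphi^{p}$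 a.e. for every $p\in\mathbb N$. $\widehat{\mathbb C^{\mathcal D_0}}$ is the ring of moderate nets modulo the ideal of negligible nets; a hat denotes the class of a net. **Asymptotic functions.** A net $(f_\varphi)\in\mathcal E(\Omega)^{\mathcal D_0}$ is moderate if for all compact $K\subseteq\Omega$ and all multi-indices $\alpha$ there is $m$ with $\sup_K|\partial^\alpha f_\varphi|\le R_\varphi^{-m}$ a.e.; it is negligible if for all such $K,\alpha$ and all $p\in\mathbb N$, $\sup_K|\partial^\alpha f_\varphi|\le R_\varphi^{p}$ a.e. $\widehat{\mathcal E(\Omega)^{\mathcal D_0}}$ is the ring of moderate nets modulo the ideal of negligible nets. The pairing with $\tau\in\mathcal D(\Omega)$ is $(\widehat{f_\varphi}\,|\,\tau)=\widehat{\int_\Omega f_\varphi\tau\,dx}\in\widehat{\mathbb C^{\mathcal D_0}}$, and $\widehat{f_\varphi}\circ\psi=\widehat{f_\varphi\circ\psi}$ for a $C^\infty$-diffeomorphism $\psi$ of an open set $\Omega'$ onto $\Omega$. **Embedding.** Let $C_{\Omega,\varphi}(x)=\int_{\widetilde\Omega_\varphi}\varphi(x-t)\,dt$ with $\widetilde\Omega_\varphi=\{x\in\Omega: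 d(x,\partial\Omega)>2R_\varphi,\ \|x\|<1/R_\varphi\}$ (where $d(x,\varnothing)=\infty$). For $T\in\mathcal D'(\Omega)$ put $(T\circledast\varphi)(x)=(T(t)\,|\,C_{\Omega,\varphi}(t)\varphi(x-t))$ for $x\in\Omega$, and $E_\Omega(T)=\widehat{T\circledast\varphi}\in\widehat{\mathcal E(\Omega)^{\mathcal D_0}}$. **Theorem (Diffeomorphisms).** For all open $\Omega,\Omega'\subseteq\mathbb R^d$, every $T\in\mathcal D'(\Omega)$ and every $C^\infty$-diffeomorphism $\psi:\Omega'\to\Omega$, the asymptotic functions $E_\Omega(T)\circ\psi$ and $E_{\Omega'}(T\circ\psi)$ on $\Omega'$ are weakly equal, that is, $$\bigl(E_\Omega(T)\circ\psi\,\big|\,\tau\bigr)=\bigl(E_{\Omega'}(T\circ\psi)\,\big|\,\tau\bigr)\quad\text{in }\widehat{\mathbb C^{\mathcal D_0}}\text{ for all }\tau\in\mathcal D(\Omega').$$ Here $T\circ\psi\in\mathcal D'(\Omega')$ is the composition of distribution theory, $(T\circ\psi\,|\,\tau)=(T\,|\,|\det D\psi^{-1}|\,(\tau\circ\psi^{-1}))$.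 -/

import Mathlib

noncomputable section

set_option linter.unusedSectionVars false

open MeasureTheory TopologicalSpace Filter Set
open scoped Distributions ContDiff Topology

namespace AsymptoticFunctions

/-- Euclidean space `ℝ^d`. -/
abbrev Euc (d : ℕ) := EuclideanSpace ℝ (Fin d)

/-- The test functions `𝓓(ℝ^d)`: the index set of all nets. -/
abbrev TestFn (d : ℕ) := 𝓓((⊤ : Opens (Euc d)), ℂ)

/-- Schwartz distributions on `Ω`: complex linear functionals on the complex valued test functions
`𝓓(Ω)` that are continuous for the canonical LF topology. -/
abbrev Distr {d : ℕ} (Ω : Opens (Euc d)) := 𝓓(Ω, ℂ) →L[ℂ] ℂ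

/-- The iterated partial derivative `∂_{I 0} ⋯ ∂_{I (k-1)} f` at `x`. A multi-index of order `k` is
presented as a sequence of `k` coordinate directions; for smooth `f` the order of the sequence does
not matter, so that these are exactly the `∂^α f` with `|α| = k`. -/
def pderiv {d k : ℕ} (I : Fin k → Fin d) (f : Euc d → ℂ) (x : Euc d) : ℂ :=
  iteratedFDeriv ℝ k f x fun j => EuclideanSpace.single (I j) (1 : ℝ)

open scoped Classical in
/-- The radius of support `R_φ`. -/
def radius {d : ℕ} (φ : TestFn d) : ℝ :=
  if φ = 0 then 1 else sSup {r : ℝ | ∃ x : Euc d, φ x ≠ 0 ∧ r = ‖x‖}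

/-- The conditions that define the directing set `𝓓_n` for `n ≥ 1`. -/
structure IsDirecting {d : ℕ} (n : ℕ) (φ : TestFn d) : Prop where
  real_valued : ∀ x, (φ x).im = 0
  even : ∀ x, φ (-x) = φ x
  radius_le : radius φ ≤ 1 / (n : ℝ)
  integral_eq_one : ∫ x, φ x = 1
  moments : ∀ α : Fin d → ℕ, 1 ≤ ∑ i, α i → ∑ i, α i ≤ n →
    ∫ x, ((∏ i, x i ^ α i : ℝ) : ℂ) * φ x = 0
  integral_norm_le : ∫ x, ‖φ x‖ ≤ 1 + 1 / (n : ℝ)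
  derivatives_le : ∀ k ≤ n, ∀ (I : Fin k → Fin d) (x : Euc d),
    ‖pderiv I φ x‖ ≤ ((radius φ)⁻¹) ^ (2 * (k + d))

/-- The directing sets `𝓓_0 = 𝓓(ℝ^d), 𝓓_1, 𝓓_2, …`. -/
def directingSet (d n : ℕ) : Set (TestFn d) := {φ | 1 ≤ n → IsDirecting n φ}

/-- An ultrafilter on `𝓓(ℝ^d)` that contains every directing set. (The `𝔠⁺`-good ultrafilters with
this property are among them; goodness is not required.) -/
structure DirectingUltrafilter (d : ℕ) where
  toUltrafilter : Ultrafilter (TestFn d)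
  directingSet_mem : ∀ n, directingSet d n ∈ toUltrafilter

/-- The filter of the sets of `𝒰`; `∀ᶠ φ in 𝒰.ae, P φ` reads "`P φ` almost everywhere". -/
def DirectingUltrafilter.ae {d : ℕ} (𝒰 : DirectingUltrafilter d) : Filter (TestFn d) :=
  𝒰.toUltrafilter

/-! ### The radius of support -/

section Radius

variable {d : ℕ}

lemma norm_le_radius (φ : TestFn d) {x : Euc d} (hx : φ x ≠ 0) : ‖x‖ ≤ radius φ := by
  have h0 : φ ≠ 0 := by rintro rfl; exact hx rfl
  rw [radius, if_neg h0]
  refine le_csSup ?_ ⟨x, hx, rfl⟩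
  obtain ⟨C, hC⟩ := φ.hasCompactSupport.isBounded.exists_norm_le
  refine ⟨C, ?_⟩
  rintro r ⟨y, hy, rfl⟩
  exact hC y (subset_tsupport _ hy)

lemma radius_pos [NeZero d] (φ : TestFn d) : 0 < radius φ := by
  by_cases h0 : φ = 0
  · rw [radius, if_pos h0]; exact one_pos
  obtain ⟨x, hx⟩ : ∃ x, φ x ≠ 0 := by
    by_contra! h
    exact h0 (TestFunction.ext h)
  have hopen : IsOpen {y : Euc d | φ y ≠ 0} := isOpen_ne_fun φ.continuous continuous_const
  have : Nonempty (Fin d) := ⟨⟨0, Nat.pos_of_neZero d⟩⟩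
  obtain ⟨y, hy, hy0⟩ : ∃ y, φ y ≠ 0 ∧ y ≠ 0 := by
    by_contra! h
    have h1 : ({y : Euc d | φ y ≠ 0}) = {0} := by
      ext y
      refine ⟨fun hy => h y hy, ?_⟩
      rintro rfl
      have := h x hx
      rwa [this] at hx
    rw [h1] at hopen
    exact not_isOpen_singleton (0 : Euc d) hopen
  exact (norm_pos_iff.2 hy0).trans_le (norm_le_radius φ hy)

variable (𝒰 : DirectingUltrafilter d)

lemma ae_isDirecting (n : ℕ) (hn : 1 ≤ n) : ∀ᶠ φ in 𝒰.ae, IsDirecting n φ := by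
  have h : ∀ᶠ φ in 𝒰.ae, φ ∈ directingSet d n := 𝒰.directingSet_mem n
  exact h.mono fun φ hφ => hφ hn

lemma ae_le_inv_radius [NeZero d] (C : ℝ) : ∀ᶠ φ in 𝒰.ae, C ≤ (radius φ)⁻¹ := by
  obtain ⟨n, hn⟩ := exists_nat_ge (max C 1)
  have hn1 : (1 : ℝ) ≤ n := (le_max_right _ _).trans hn
  refine (ae_isDirecting 𝒰 n (by exact_mod_cast hn1)).mono fun φ hφ => ?_
  have h := hφ.radius_le
  rw [one_div] at h
  exact ((le_max_left _ _).trans hn).trans ((le_inv_comm₀ (radius_pos φ) (by linarith)).1 h)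

lemma ae_radius_lt [NeZero d] {ε : ℝ} (hε : 0 < ε) : ∀ᶠ φ in 𝒰.ae, radius φ < ε := by
  refine (ae_le_inv_radius 𝒰 (ε⁻¹ + 1)).mono fun φ hφ => ?_
  have : ε⁻¹ < (radius φ)⁻¹ := by linarith
  exact (inv_lt_inv₀ hε (radius_pos φ)).1 this

end Radius

/-! ### Growth of nets -/

section Growth

variable {d : ℕ} [NeZero d] (𝒰 : DirectingUltrafilter d) {X : Type*} (K : Set X)

/-- Uniform growth of at most `R_φ ^ (-m)` on `K`. -/
def ModOn (b : TestFn d → X → ℝ) : Prop :=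
  ∃ m : ℕ, ∀ᶠ φ in 𝒰.ae, ∀ x ∈ K, b φ x ≤ ((radius φ)⁻¹) ^ m

/-- Uniform decay faster than all powers of `R_φ` on `K`. -/
def NegOn (b : TestFn d → X → ℝ) : Prop :=
  ∀ p : ℕ, ∀ᶠ φ in 𝒰.ae, ∀ x ∈ K, b φ x ≤ radius φ ^ p

variable {𝒰 K} {a b c : TestFn d → X → ℝ}

lemma ModOn.mono (hb : ModOn 𝒰 K b) (h : ∀ φ, ∀ x ∈ K, a φ x ≤ b φ x) : ModOn 𝒰 K a := by
  obtain ⟨m, hm⟩ := hb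
  exact ⟨m, hm.mono fun φ hφ x hx => (h φ x hx).trans (hφ x hx)⟩

lemma NegOn.mono (hb : NegOn 𝒰 K b) (h : ∀ φ, ∀ x ∈ K, a φ x ≤ b φ x) : NegOn 𝒰 K a :=
  fun p => (hb p).mono fun φ hφ x hx => (h φ x hx).trans (hφ x hx)

lemma ModOn.const (C : ℝ) : ModOn 𝒰 K (fun _ _ => C) :=
  ⟨1, (ae_le_inv_radius 𝒰 C).mono fun φ hφ _ _ => by simpa using hφ⟩

lemma NegOn.zero : NegOn 𝒰 K (fun _ _ => 0) :=
  fun p => Eventually.of_forall fun φ _ _ => pow_nonneg (radius_pos φ).le p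

lemma ModOn.mul (ha : ModOn 𝒰 K a) (hb : ModOn 𝒰 K b) (hb0 : ∀ φ x, 0 ≤ b φ x) :
    ModOn 𝒰 K (fun φ x => a φ x * b φ x) := by
  obtain ⟨m, hm⟩ := ha
  obtain ⟨n, hn⟩ := hb
  refine ⟨m + n, ?_⟩
  filter_upwards [hm, hn] with φ h1 h2 x hx
  rw [pow_add]
  have := radius_pos φ
  exact mul_le_mul (h1 x hx) (h2 x hx) (hb0 φ x) (by positivity)

lemma ModOn.add (ha : ModOn 𝒰 K a) (hb : ModOn 𝒰 K b) :
    ModOn 𝒰 K (fun φ x => a φ x + b φ x) := by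
  obtain ⟨m, hm⟩ := ha
  obtain ⟨n, hn⟩ := hb
  refine ⟨m + n + 1, ?_⟩
  filter_upwards [hm, hn, ae_le_inv_radius 𝒰 2] with φ h1 h2 h3 x hx
  have h4 : (1 : ℝ) ≤ (radius φ)⁻¹ := by linarith
  have h5 : ((radius φ)⁻¹) ^ m ≤ ((radius φ)⁻¹) ^ (m + n) := pow_le_pow_right₀ h4 (by omega)
  have h6 : ((radius φ)⁻¹) ^ n ≤ ((radius φ)⁻¹) ^ (m + n) := pow_le_pow_right₀ h4 (by omega)
  have h7 : 0 ≤ ((radius φ)⁻¹) ^ (m + n) := by positivity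
  rw [pow_succ]
  nlinarith [h1 x hx, h2 x hx]

lemma NegOn.mul_mod (ha : NegOn 𝒰 K a) (hb : ModOn 𝒰 K b) (hb0 : ∀ φ x, 0 ≤ b φ x) :
    NegOn 𝒰 K (fun φ x => a φ x * b φ x) := by
  obtain ⟨n, hn⟩ := hb
  intro p
  filter_upwards [ha (p + n), hn] with φ h1 h2 x hx
  have h3 := radius_pos φ
  calc a φ x * b φ x ≤ radius φ ^ (p + n) * ((radius φ)⁻¹) ^ n :=
        mul_le_mul (h1 x hx) (h2 x hx) (hb0 φ x) (by positivity)
    _ = radius φ ^ p := by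
        rw [pow_add, mul_assoc, ← mul_pow, mul_inv_cancel₀ h3.ne', one_pow, mul_one]

lemma NegOn.add (ha : NegOn 𝒰 K a) (hb : NegOn 𝒰 K b) :
    NegOn 𝒰 K (fun φ x => a φ x + b φ x) := by
  intro p
  filter_upwards [ha (p + 1), hb (p + 1), ae_radius_lt 𝒰 (show (0 : ℝ) < 1 / 2 by norm_num)]
    with φ h1 h2 h3 x hx
  have h7 : 0 ≤ radius φ ^ p := pow_nonneg (radius_pos φ).le p
  have h8 := h1 x hx
  have h9 := h2 x hx
  rw [pow_succ] at h8 h9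
  nlinarith

lemma ModOn.sum {ι : Type*} (s : Finset ι) {f : ι → TestFn d → X → ℝ}
    (h : ∀ i ∈ s, ModOn 𝒰 K (f i)) : ModOn 𝒰 K (fun φ x => ∑ i ∈ s, f i φ x) := by
  classical
  induction s using Finset.induction_on with
  | empty => simpa using ModOn.const (𝒰 := 𝒰) (K := K) 0
  | insert i s hi ih =>
    simp only [Finset.sum_insert hi]
    exact (h i (Finset.mem_insert_self _ _)).add
      (ih fun j hj => h j (Finset.mem_insert_of_mem hj))

lemma NegOn.sum {ι : Type*} (s : Finset ι) {f : ι → TestFn d → X → ℝ}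
    (h : ∀ i ∈ s, NegOn 𝒰 K (f i)) : NegOn 𝒰 K (fun φ x => ∑ i ∈ s, f i φ x) := by
  classical
  induction s using Finset.induction_on with
  | empty => simpa using NegOn.zero (𝒰 := 𝒰) (K := K)
  | insert i s hi ih =>
    simp only [Finset.sum_insert hi]
    exact (h i (Finset.mem_insert_self _ _)).add
      (ih fun j hj => h j (Finset.mem_insert_of_mem hj))

lemma NegOn.const_mul (C : ℝ) (hC : 0 ≤ C) (ha : NegOn 𝒰 K a) :
    NegOn 𝒰 K (fun φ x => a φ x * C) :=
  ha.mul_mod (ModOn.const C) fun _ _ => hC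

lemma NegOn.eventually_lt (ha : NegOn 𝒰 K a) (p : ℕ) :
    ∀ᶠ φ in 𝒰.ae, ∀ x ∈ K, a φ x < radius φ ^ p := by
  filter_upwards [ha (p + 1), ae_radius_lt 𝒰 one_pos] with φ h1 h2 x hx
  refine (h1 x hx).trans_lt ?_
  rw [pow_succ]
  have := radius_pos φ
  exact mul_lt_of_lt_one_right (by positivity) h2

end Growth

/-! ### Asymptotic numbers -/

section Numbers

variable {d : ℕ} [NeZero d] (𝒰 : DirectingUltrafilter d)

/-- The moderate nets in `ℂ`. -/
def moderateNum : Subring (TestFn d → ℂ) where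
  carrier := {A | ∃ m : ℕ, ∀ᶠ φ in 𝒰.ae, ‖A φ‖ ≤ ((radius φ)⁻¹) ^ m}
  mul_mem' := by
    intro A B hA hB
    have hA' : ModOn 𝒰 (univ : Set Unit) (fun φ _ => ‖A φ‖) := by simpa [ModOn] using hA
    have hB' : ModOn 𝒰 (univ : Set Unit) (fun φ _ => ‖B φ‖) := by simpa [ModOn] using hB
    simpa [ModOn] using hA'.mul hB' fun _ _ => norm_nonneg _
  one_mem' := by
    simpa [ModOn] using ModOn.const (𝒰 := 𝒰) (K := (univ : Set Unit)) 1
  add_mem' := by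
    intro A B hA hB
    have hA' : ModOn 𝒰 (univ : Set Unit) (fun φ _ => ‖A φ‖) := by simpa [ModOn] using hA
    have hB' : ModOn 𝒰 (univ : Set Unit) (fun φ _ => ‖B φ‖) := by simpa [ModOn] using hB
    have := (hA'.add hB').mono (a := fun φ _ => ‖A φ + B φ‖) fun φ _ _ => norm_add_le _ _
    simpa [ModOn] using this
  zero_mem' := by
    simpa [ModOn] using ModOn.const (𝒰 := 𝒰) (K := (univ : Set Unit)) 0
  neg_mem' := by
    intro A hA
    simpa using hA

variable {𝒰} in
lemma negOn_iff_num {A : TestFn d → ℂ} : NegOn 𝒰 (univ : Set Unit) (fun φ _ => ‖A φ‖) ↔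
    ∀ p : ℕ, ∀ᶠ φ in 𝒰.ae, ‖A φ‖ < radius φ ^ p := by
  constructor
  · intro h p
    simpa using h.eventually_lt p
  · intro h p
    exact (h p).mono fun φ hφ _ _ => hφ.le

/-- The ideal of the negligible nets in the ring of the moderate nets in `ℂ`. -/
def negligibleNum : Ideal (moderateNum 𝒰) where
  carrier := {A | ∀ p : ℕ, ∀ᶠ φ in 𝒰.ae, ‖A.1 φ‖ < radius φ ^ p}
  add_mem' := by
    intro A B hA hB
    refine negOn_iff_num.1 ?_
    exact ((negOn_iff_num.2 hA).add (negOn_iff_num.2 hB)).mono fun φ _ _ => norm_add_le _ _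
  zero_mem' := by
    refine negOn_iff_num.1 ?_
    exact (NegOn.zero).mono fun φ _ _ => by simp
  smul_mem' := by
    intro A B hB
    refine negOn_iff_num.1 ?_
    have hA' : ModOn 𝒰 (univ : Set Unit) (fun φ _ => ‖A.1 φ‖) := by
      obtain ⟨m, hm⟩ := A.2
      exact ⟨m, hm.mono fun φ hφ _ _ => hφ⟩
    exact ((negOn_iff_num.2 hB).mul_mod hA' fun _ _ => norm_nonneg _).mono fun φ _ _ => by
      simp [mul_comm]

/-- The asymptotic numbers: moderate nets in `ℂ` modulo negligible nets. -/
abbrev AsymNum := moderateNum 𝒰 ⧸ negligibleNum 𝒰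

end Numbers

/-! ### Smooth functions on an open set -/

section Smooth

variable {d : ℕ} {Ω : Opens (Euc d)}

open scoped Classical in
/-- The extension of a function on `Ω` by zero; on the open set `Ω` it has the derivatives of the
given function. -/
def zeroExt (f : Ω → ℂ) (x : Euc d) : ℂ := if h : x ∈ Ω then f ⟨x, h⟩ else 0

lemma zeroExt_of_mem (f : Ω → ℂ) {x : Euc d} (h : x ∈ Ω) : zeroExt f x = f ⟨x, h⟩ := by
  rw [zeroExt, dif_pos h]

lemma zeroExt_eventuallyEq {f : Ω → ℂ} {g : Euc d → ℂ} (h : ∀ y : Ω, f y = g y) {x : Euc d}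
    (hx : x ∈ Ω) : zeroExt f =ᶠ[𝓝 x] g := by
  filter_upwards [Ω.isOpen.mem_nhds hx] with y hy
  rw [zeroExt_of_mem f hy, h]

lemma zeroExt_eqOn {f : Ω → ℂ} {g : Euc d → ℂ} (h : ∀ y : Ω, f y = g y) :
    EqOn (zeroExt f) g Ω := fun y hy => by
  rw [zeroExt_of_mem f hy, h]

variable (Ω) in
/-- The algebra `𝓔(Ω)` of the smooth functions `Ω → ℂ`. -/
def smoothFn : Subalgebra ℂ (Ω → ℂ) where
  carrier := {f | ContDiffOn ℝ ∞ (zeroExt f) (Ω : Set (Euc d))}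
  mul_mem' := by
    intro f g hf hg
    refine (ContDiffOn.mul hf hg).congr (zeroExt_eqOn ?_)
    intro y
    simp [zeroExt_of_mem _ y.2]
  add_mem' := by
    intro f g hf hg
    refine (ContDiffOn.add hf hg).congr (zeroExt_eqOn ?_)
    intro y
    simp [zeroExt_of_mem _ y.2]
  algebraMap_mem' := by
    intro r
    refine (contDiffOn_const (c := r)).congr (zeroExt_eqOn ?_)
    intro y
    rfl

/-- The value at `x ∈ Ω` of a smooth function, extended by zero to `ℝ^d`. -/
def fnExt (f : smoothFn Ω) : Euc d → ℂ := zeroExt f.1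

lemma fnExt_contDiffOn (f : smoothFn Ω) : ContDiffOn ℝ ∞ (fnExt f) Ω := f.2

/-- The operator norm of a derivative is controlled by the partial derivatives. -/
lemma norm_iteratedFDeriv_le_sum_pderiv (k : ℕ) (f : Euc d → ℂ) (x : Euc d) :
    ‖iteratedFDeriv ℝ k f x‖ ≤ ∑ I : Fin k → Fin d, ‖pderiv I f x‖ := by
  refine ContinuousMultilinearMap.opNorm_le_bound (by positivity) fun v => ?_
  have hv : v = fun j => ∑ i : Fin d, v j i • EuclideanSpace.single i (1 : ℝ) := by
    ext j i
    simp [Finset.sum_apply, Pi.single_apply]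
  conv_lhs => rw [hv]
  have h := (iteratedFDeriv ℝ k f x).toMultilinearMap.map_sum
    (fun j i => v j i • EuclideanSpace.single i (1 : ℝ))
  rw [ContinuousMultilinearMap.coe_coe] at h
  rw [h, Finset.sum_mul]
  refine (norm_sum_le _ _).trans (Finset.sum_le_sum fun I _ => ?_)
  have h2 := (iteratedFDeriv ℝ k f x).map_smul_univ (fun j => v j (I j))
    (fun j => EuclideanSpace.single (I j) (1 : ℝ))
  rw [h2, norm_smul, mul_comm]
  refine mul_le_mul_of_nonneg_left ?_ (norm_nonneg _)
  rw [norm_prod]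
  exact Finset.prod_le_prod (fun _ _ => norm_nonneg _) fun j _ => PiLp.norm_apply_le (v j) (I j)

lemma norm_pderiv_le {k : ℕ} (I : Fin k → Fin d) (f : Euc d → ℂ) (x : Euc d) :
    ‖pderiv I f x‖ ≤ ‖iteratedFDeriv ℝ k f x‖ := by
  refine (ContinuousMultilinearMap.le_opNorm _ _).trans ?_
  simp

lemma fnExt_contDiffAt (f : smoothFn Ω) {x : Euc d} (hx : x ∈ Ω) : ContDiffAt ℝ ∞ (fnExt f) x :=
  (fnExt_contDiffOn f).contDiffAt (Ω.isOpen.mem_nhds hx)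

lemma ext_add_eventuallyEq (f g : smoothFn Ω) {x : Euc d} (hx : x ∈ Ω) :
    (fnExt (f + g)) =ᶠ[𝓝 x] (fnExt f) + (fnExt g) :=
  zeroExt_eventuallyEq (fun y => by simp [fnExt, zeroExt_of_mem _ y.2]) hx

lemma ext_mul_eventuallyEq (f g : smoothFn Ω) {x : Euc d} (hx : x ∈ Ω) :
    (fnExt (f * g)) =ᶠ[𝓝 x] fun y => (fnExt f) y * (fnExt g) y :=
  zeroExt_eventuallyEq (fun y => by simp [fnExt, zeroExt_of_mem _ y.2]) hx

lemma norm_iteratedFDeriv_ext_add_le (f g : smoothFn Ω) (k : ℕ) {x : Euc d} (hx : x ∈ Ω) :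
    ‖iteratedFDeriv ℝ k (fnExt (f + g)) x‖ ≤
      ‖iteratedFDeriv ℝ k (fnExt f) x‖ + ‖iteratedFDeriv ℝ k (fnExt g) x‖ := by
  rw [((ext_add_eventuallyEq f g hx).iteratedFDeriv ℝ k).eq_of_nhds,
    iteratedFDeriv_add_apply ((fnExt_contDiffAt f hx).of_le (by exact_mod_cast le_top))
      ((fnExt_contDiffAt g hx).of_le (by exact_mod_cast le_top))]
  exact norm_add_le _ _

lemma norm_iteratedFDeriv_ext_neg (f : smoothFn Ω) (k : ℕ) {x : Euc d} (hx : x ∈ Ω) :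
    ‖iteratedFDeriv ℝ k (fnExt (-f)) x‖ = ‖iteratedFDeriv ℝ k (fnExt f) x‖ := by
  have h : (fnExt (-f)) =ᶠ[𝓝 x] -(fnExt f) :=
    zeroExt_eventuallyEq (fun y => by simp [fnExt, zeroExt_of_mem _ y.2]) hx
  rw [(h.iteratedFDeriv ℝ k).eq_of_nhds, iteratedFDeriv_neg_apply, norm_neg]

lemma norm_iteratedFDeriv_ext_mul_le (f g : smoothFn Ω) (k : ℕ) {x : Euc d} (hx : x ∈ Ω) :
    ‖iteratedFDeriv ℝ k (fnExt (f * g)) x‖ ≤ ∑ i ∈ Finset.range (k + 1),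
      (k.choose i : ℝ) * ‖iteratedFDeriv ℝ i (fnExt f) x‖ * ‖iteratedFDeriv ℝ (k - i) (fnExt g) x‖ := by
  rw [((ext_mul_eventuallyEq f g hx).iteratedFDeriv ℝ k).eq_of_nhds]
  have h := norm_iteratedFDerivWithin_mul_le (fnExt_contDiffOn f) (fnExt_contDiffOn g) Ω.isOpen.uniqueDiffOn hx
    (n := k) (by exact_mod_cast le_top)
  simpa only [iteratedFDerivWithin_of_isOpen _ Ω.isOpen hx] using h

lemma iteratedFDeriv_ext_const (c : ℂ) (k : ℕ) {x : Euc d} (hx : x ∈ Ω) :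
    ‖iteratedFDeriv ℝ k (fnExt (algebraMap ℂ (smoothFn Ω) c)) x‖ ≤ ‖c‖ := by
  have h : (fnExt (algebraMap ℂ (smoothFn Ω) c)) =ᶠ[𝓝 x] fun _ => c :=
    zeroExt_eventuallyEq (g := fun _ => c) (fun y => rfl) hx
  rw [(h.iteratedFDeriv ℝ k).eq_of_nhds]
  rcases Nat.eq_zero_or_pos k with rfl | hk
  · simp
  · rw [iteratedFDeriv_const_of_ne hk.ne']
    simp

variable [NeZero d] (𝒰 : DirectingUltrafilter d)

variable {𝒰} in
lemma modOn_pderiv_iff {K : Set (Euc d)} {k : ℕ} {f : TestFn d → Euc d → ℂ} :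
    (∀ I : Fin k → Fin d, ModOn 𝒰 K fun φ x => ‖pderiv I (f φ) x‖) ↔
      ModOn 𝒰 K fun φ x => ‖iteratedFDeriv ℝ k (f φ) x‖ := by
  constructor
  · intro h
    exact (ModOn.sum Finset.univ fun I _ => h I).mono fun φ x _ =>
      norm_iteratedFDeriv_le_sum_pderiv k _ x
  · intro h I
    exact h.mono fun φ x _ => norm_pderiv_le I _ x

variable {𝒰} in
lemma negOn_pderiv_iff {K : Set (Euc d)} {k : ℕ} {f : TestFn d → Euc d → ℂ} :
    (∀ I : Fin k → Fin d, NegOn 𝒰 K fun φ x => ‖pderiv I (f φ) x‖) ↔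
      NegOn 𝒰 K fun φ x => ‖iteratedFDeriv ℝ k (f φ) x‖ := by
  constructor
  · intro h
    exact (NegOn.sum Finset.univ fun I _ => h I).mono fun φ x _ =>
      norm_iteratedFDeriv_le_sum_pderiv k _ x
  · intro h I
    exact h.mono fun φ x _ => norm_pderiv_le I _ x

/-- Moderate nets of smooth functions: on every compact `K ⊆ Ω` every partial derivative satisfies
`sup_K |∂^α f_φ| ≤ R_φ ^ (-m)` almost everywhere, for some `m`. -/
def IsModerate (f : TestFn d → smoothFn Ω) : Prop :=
  ∀ K : Set (Euc d), IsCompact K → K ⊆ Ω → ∀ (k : ℕ) (I : Fin k → Fin d),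
    ∃ m : ℕ, ∀ᶠ φ in 𝒰.ae, ∀ x ∈ K, ‖pderiv I (fnExt (f φ)) x‖ ≤ ((radius φ)⁻¹) ^ m

/-- Negligible nets of smooth functions: on every compact `K ⊆ Ω` every partial derivative satisfies
`sup_K |∂^α f_φ| ≤ R_φ ^ p` almost everywhere, for all `p`. -/
def IsNegligible (f : TestFn d → smoothFn Ω) : Prop :=
  ∀ K : Set (Euc d), IsCompact K → K ⊆ Ω → ∀ (k : ℕ) (I : Fin k → Fin d),
    ∀ p : ℕ, ∀ᶠ φ in 𝒰.ae, ∀ x ∈ K, ‖pderiv I (fnExt (f φ)) x‖ ≤ radius φ ^ p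

variable {𝒰}

lemma isModerate_iff {f : TestFn d → smoothFn Ω} : IsModerate 𝒰 f ↔
    ∀ K : Set (Euc d), IsCompact K → K ⊆ Ω → ∀ k : ℕ,
      ModOn 𝒰 K fun φ x => ‖iteratedFDeriv ℝ k (fnExt (f φ)) x‖ :=
  forall_congr' fun _ => forall_congr' fun _ => forall_congr' fun _ => forall_congr' fun _ =>
    modOn_pderiv_iff (f := fun φ => (fnExt (f φ)))

lemma isNegligible_iff {f : TestFn d → smoothFn Ω} : IsNegligible 𝒰 f ↔
    ∀ K : Set (Euc d), IsCompact K → K ⊆ Ω → ∀ k : ℕ,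
      NegOn 𝒰 K fun φ x => ‖iteratedFDeriv ℝ k (fnExt (f φ)) x‖ :=
  forall_congr' fun _ => forall_congr' fun _ => forall_congr' fun _ => forall_congr' fun _ =>
    negOn_pderiv_iff (f := fun φ => (fnExt (f φ)))

variable (𝒰 Ω) in
/-- The differential ring of the moderate nets in `𝓔(Ω)`. -/
def moderateFn : Subring (TestFn d → smoothFn Ω) where
  carrier := {f | IsModerate 𝒰 f}
  mul_mem' := by
    intro f g hf hg
    refine isModerate_iff.2 fun K hK hKΩ k => ?_
    refine (ModOn.sum (Finset.range (k + 1)) fun i _ =>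
      ((ModOn.const (k.choose i : ℝ)).mul (isModerate_iff.1 hf K hK hKΩ i)
        fun _ _ => norm_nonneg _).mul (isModerate_iff.1 hg K hK hKΩ (k - i))
          fun _ _ => norm_nonneg _).mono fun φ x hx => ?_
    exact norm_iteratedFDeriv_ext_mul_le (f φ) (g φ) k (hKΩ hx)
  one_mem' := by
    refine isModerate_iff.2 fun K hK hKΩ k => ?_
    refine (ModOn.const ‖(1 : ℂ)‖).mono fun φ x hx => ?_
    have := iteratedFDeriv_ext_const (Ω := Ω) 1 k (hKΩ hx)
    rwa [map_one] at this
  add_mem' := by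
    intro f g hf hg
    refine isModerate_iff.2 fun K hK hKΩ k => ?_
    exact ((isModerate_iff.1 hf K hK hKΩ k).add (isModerate_iff.1 hg K hK hKΩ k)).mono
      fun φ x hx => norm_iteratedFDeriv_ext_add_le (f φ) (g φ) k (hKΩ hx)
  zero_mem' := by
    refine isModerate_iff.2 fun K hK hKΩ k => ?_
    refine (ModOn.const ‖(0 : ℂ)‖).mono fun φ x hx => ?_
    have := iteratedFDeriv_ext_const (Ω := Ω) 0 k (hKΩ hx)
    rwa [map_zero] at this
  neg_mem' := by
    intro f hf
    refine isModerate_iff.2 fun K hK hKΩ k => ?_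
    exact (isModerate_iff.1 hf K hK hKΩ k).mono
      fun φ x hx => (norm_iteratedFDeriv_ext_neg (f φ) k (hKΩ hx)).le

variable (𝒰 Ω) in
/-- The ideal of the negligible nets in the ring of the moderate nets in `𝓔(Ω)`. -/
def negligibleFn : Ideal (moderateFn Ω 𝒰) where
  carrier := {f | IsNegligible 𝒰 f.1}
  add_mem' := by
    intro f g hf hg
    refine isNegligible_iff.2 fun K hK hKΩ k => ?_
    exact ((isNegligible_iff.1 hf K hK hKΩ k).add (isNegligible_iff.1 hg K hK hKΩ k)).mono
      fun φ x hx => norm_iteratedFDeriv_ext_add_le (f.1 φ) (g.1 φ) k (hKΩ hx)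
  zero_mem' := by
    refine isNegligible_iff.2 fun K hK hKΩ k => ?_
    refine NegOn.zero.mono fun φ x hx => ?_
    have := iteratedFDeriv_ext_const (Ω := Ω) 0 k (hKΩ hx)
    rwa [map_zero, norm_zero] at this
  smul_mem' := by
    intro g f hf
    refine isNegligible_iff.2 fun K hK hKΩ k => ?_
    refine (NegOn.sum (Finset.range (k + 1)) fun i _ =>
      ((isNegligible_iff.1 hf K hK hKΩ i).const_mul (k.choose i : ℝ) (by positivity)).mul_mod
        (isModerate_iff.1 g.2 K hK hKΩ (k - i)) fun _ _ => norm_nonneg _).mono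
          fun φ x hx => ?_
    have := norm_iteratedFDeriv_ext_mul_le (f.1 φ) (g.1 φ) k (hKΩ hx)
    rw [smul_eq_mul, mul_comm g f]
    change ‖iteratedFDeriv ℝ k (fnExt (f.1 φ * g.1 φ)) x‖ ≤ _
    simpa only [mul_comm (k.choose _ : ℝ)] using this

variable (𝒰 Ω) in
/-- The asymptotic functions on `Ω`: moderate nets in `𝓔(Ω)` modulo negligible nets. -/
abbrev AsymFn := moderateFn Ω 𝒰 ⧸ negligibleFn Ω 𝒰

end Smooth
/-! ### Pairing with test functions -/

section Pairing

variable {d : ℕ} {Ω : Opens (Euc d)}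

lemma integrable_fnExt_mul (f : smoothFn Ω) (τ : 𝓓(Ω, ℂ)) :
    IntegrableOn (fun x => fnExt f x * τ x) Ω := by
  have h : ContinuousOn (fun x => fnExt f x * τ x) (tsupport τ) :=
    ((fnExt_contDiffOn f).continuousOn.mono τ.tsupport_subset).mul τ.continuous.continuousOn
  have h2 : IntegrableOn (fun x => fnExt f x * τ x) (tsupport τ) :=
    h.integrableOn_compact τ.hasCompactSupport
  refine ((integrableOn_iff_integrable_of_support_subset ?_).1 h2).integrableOn
  intro x hx
  refine subset_tsupport _ ?_
  intro h0
  simp [h0] at hx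

/-- The pairing `(f | τ) = ∫_Ω f τ` of a smooth function with a test function. -/
def fnPairing (τ : 𝓓(Ω, ℂ)) : smoothFn Ω →+ ℂ where
  toFun f := ∫ x in Ω, fnExt f x * τ x
  map_zero' := by
    refine (setIntegral_congr_fun Ω.isOpen.measurableSet (g := fun _ => 0) ?_).trans (by simp)
    intro x hx
    have : fnExt (0 : smoothFn Ω) x = 0 := zeroExt_of_mem _ hx
    simp [this]
  map_add' f g := by
    rw [← integral_add (integrable_fnExt_mul f τ) (integrable_fnExt_mul g τ)]
    refine setIntegral_congr_fun Ω.isOpen.measurableSet ?_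
    intro x hx
    have := (ext_add_eventuallyEq f g hx).eq_of_nhds
    simp only [this, Pi.add_apply, add_mul]

lemma norm_fnPairing_le (τ : 𝓓(Ω, ℂ)) {f : smoothFn Ω} {B : ℝ} (hB : 0 ≤ B)
    (h : ∀ x ∈ tsupport τ, ‖iteratedFDeriv ℝ 0 (fnExt f) x‖ ≤ B) :
    ‖fnPairing τ f‖ ≤ B * ∫ x, ‖τ x‖ := by
  have hi : Integrable (fun x => ‖τ x‖) :=
    (τ.continuous.integrable_of_hasCompactSupport τ.hasCompactSupport).norm
  have hle : ∀ x, ‖fnExt f x * τ x‖ ≤ B * ‖τ x‖ := by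
    intro x
    rw [norm_mul]
    by_cases hx : x ∈ tsupport τ
    · have := h x hx
      rw [norm_iteratedFDeriv_zero] at this
      exact mul_le_mul_of_nonneg_right this (norm_nonneg _)
    · simp [image_eq_zero_of_notMem_tsupport hx]
  refine (norm_integral_le_of_norm_le (hi.const_mul B).integrableOn
    (Eventually.of_forall hle)).trans ?_
  rw [integral_const_mul]
  exact mul_le_mul_of_nonneg_left
    (setIntegral_le_integral hi (Eventually.of_forall fun _ => norm_nonneg _)) hB

variable [NeZero d] {𝒰 : DirectingUltrafilter d}

lemma fnPairing_moderate (τ : 𝓓(Ω, ℂ)) (f : moderateFn Ω 𝒰) :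
    (fun φ => fnPairing τ (f.1 φ)) ∈ moderateNum 𝒰 := by
  have h := (isModerate_iff.1 f.2 _ τ.hasCompactSupport τ.tsupport_subset 0)
  obtain ⟨m, hm⟩ := h
  have hC : 0 ≤ ∫ x, ‖τ x‖ := integral_nonneg fun _ => norm_nonneg _
  have h2 : ModOn 𝒰 (univ : Set Unit) (fun φ _ => ((radius φ)⁻¹) ^ m * ∫ x, ‖τ x‖) :=
    (ModOn.mul (a := fun φ _ => ((radius φ)⁻¹) ^ m)
      ⟨m, Eventually.of_forall fun φ _ _ => le_rfl⟩ (ModOn.const _) fun _ _ => hC)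
  obtain ⟨n, hn⟩ := h2
  refine ⟨n, ?_⟩
  filter_upwards [hm, hn] with φ h1 h2
  have := radius_pos φ
  exact (norm_fnPairing_le τ (by positivity) h1).trans (h2 () trivial)

lemma fnPairing_negligible (τ : 𝓓(Ω, ℂ)) {f : TestFn d → smoothFn Ω} (hf : IsNegligible 𝒰 f) :
    ∀ p : ℕ, ∀ᶠ φ in 𝒰.ae, ‖fnPairing τ (f φ)‖ < radius φ ^ p := by
  refine negOn_iff_num.1 fun p => ?_
  have h := (isNegligible_iff.1 hf _ τ.hasCompactSupport τ.tsupport_subset 0)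
  filter_upwards [h (p + 1), ae_le_inv_radius 𝒰 (∫ x, ‖τ x‖)] with φ h1 h2 _ _
  have h3 := radius_pos φ
  calc ‖fnPairing τ (f φ)‖ ≤ radius φ ^ (p + 1) * ∫ x, ‖τ x‖ :=
        norm_fnPairing_le τ (by positivity) h1
    _ ≤ radius φ ^ (p + 1) * (radius φ)⁻¹ := by gcongr
    _ = radius φ ^ p := by rw [pow_succ, mul_assoc, mul_inv_cancel₀ h3.ne', mul_one]

/-- The pairing of an asymptotic function with a test function, an asymptotic number: the class of
the net `φ ↦ ∫_Ω f_φ τ`. -/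
def pairing (F : AsymFn Ω 𝒰) (τ : 𝓓(Ω, ℂ)) : AsymNum 𝒰 :=
  Quotient.liftOn' F
    (fun f => Ideal.Quotient.mk (negligibleNum 𝒰)
      ⟨fun φ => fnPairing τ (f.1 φ), fnPairing_moderate τ f⟩)
    (by
      intro f g hfg
      have h : f - g ∈ negligibleFn Ω 𝒰 := (Submodule.quotientRel_def _).1 hfg
      refine Ideal.Quotient.eq.2 ?_
      intro p
      refine (fnPairing_negligible τ (f := fun φ => f.1 φ - g.1 φ) h p).mono fun φ hφ => ?_
      rw [map_sub] at hφ
      exact hφ)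

/-- Weak equality of asymptotic functions: equality of the pairings with all test functions. -/
def WeaklyEqual (F G : AsymFn Ω 𝒰) : Prop := ∀ τ : 𝓓(Ω, ℂ), pairing F τ = pairing G τ

end Pairing

/-! ### Diffeomorphisms and change of variables -/

section Diffeo

variable {d : ℕ}

/-- The smooth diffeomorphisms from `Ω'` onto `Ω`, presented by a pair of maps of `ℝ^d` of which
only the restrictions to `Ω'` and to `Ω` matter. -/
structure Diffeo (Ω' Ω : Opens (Euc d)) where
  toFun : Euc d → Euc d
  invFun : Euc d → Euc d
  mapsTo : ∀ x ∈ Ω', toFun x ∈ Ω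
  mapsTo_inv : ∀ y ∈ Ω, invFun y ∈ Ω'
  left_inv : ∀ x ∈ Ω', invFun (toFun x) = x
  right_inv : ∀ y ∈ Ω, toFun (invFun y) = y
  contDiffOn : ContDiffOn ℝ ∞ toFun Ω'
  contDiffOn_inv : ContDiffOn ℝ ∞ invFun Ω

variable {Ω' Ω : Opens (Euc d)} (ψ : Diffeo Ω' Ω)

lemma zeroExt_comp_eqOn (f : Ω → ℂ) :
    EqOn (zeroExt fun x : Ω' => f ⟨ψ.toFun x, ψ.mapsTo x x.2⟩) (zeroExt f ∘ ψ.toFun) Ω' :=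
  zeroExt_eqOn fun y => (zeroExt_of_mem f (ψ.mapsTo y y.2)).symm

/-- The composition `f ∘ ψ` of a smooth function on `Ω` with a diffeomorphism `ψ : Ω' → Ω`. -/
def fnComp (f : smoothFn Ω) : smoothFn Ω' :=
  ⟨fun x => f.1 ⟨ψ.toFun x, ψ.mapsTo x x.2⟩,
    ((fnExt_contDiffOn f).comp ψ.contDiffOn ψ.mapsTo).congr (zeroExt_comp_eqOn ψ f.1)⟩

/-- On compact sets the derivatives of a smooth map are bounded. -/
lemma exists_bound_iteratedFDeriv {F : Type*} [NormedAddCommGroup F] [NormedSpace ℝ F]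
    {g : Euc d → F} (hg : ContDiffOn ℝ ∞ g Ω') {K : Set (Euc d)} (hK : IsCompact K) (hKΩ : K ⊆ Ω')
    (k : ℕ) : ∃ D : ℝ, 1 ≤ D ∧ ∀ i ≤ k, ∀ x ∈ K, ‖iteratedFDeriv ℝ i g x‖ ≤ D := by
  have h : ∀ i : ℕ, ∃ D : ℝ, 1 ≤ D ∧ ∀ x ∈ K, ‖iteratedFDeriv ℝ i g x‖ ≤ D := by
    intro i
    have hc : ContinuousOn (iteratedFDeriv ℝ i g) Ω' :=
      (hg.continuousOn_iteratedFDerivWithin (by exact_mod_cast le_top)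
        Ω'.isOpen.uniqueDiffOn).congr fun x hx => (iteratedFDerivWithin_of_isOpen i Ω'.isOpen hx).symm
    obtain ⟨C, hC⟩ := hK.exists_bound_of_continuousOn (hc.mono hKΩ)
    exact ⟨max C 1, le_max_right _ _, fun x hx => (hC x hx).trans (le_max_left _ _)⟩
  choose D hD1 hD using h
  refine ⟨∑ i ∈ Finset.range (k + 1), D i, ?_, ?_⟩
  · refine (hD1 0).trans (Finset.single_le_sum (f := D) (fun i _ => ?_) (by simp))
    exact zero_le_one.trans (hD1 i)
  · intro i hi x hx
    refine (hD i x hx).trans (Finset.single_le_sum (f := D) (fun j _ => ?_) (by simp; omega))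
    exact zero_le_one.trans (hD1 j)

lemma norm_iteratedFDeriv_comp_diffeo_le {F : Type*} [NormedAddCommGroup F] [NormedSpace ℝ F]
    {K : Set (Euc d)} (hK : IsCompact K) (hKΩ : K ⊆ Ω')
    (k : ℕ) : ∃ D : ℝ, 0 ≤ D ∧ ∀ g : Euc d → F, ContDiffOn ℝ ∞ g Ω → ∀ x ∈ K, ∀ C : ℝ,
      (∀ i ≤ k, ‖iteratedFDeriv ℝ i g (ψ.toFun x)‖ ≤ C) →
        ‖iteratedFDeriv ℝ k (g ∘ ψ.toFun) x‖ ≤ D * C := by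
  obtain ⟨D, hD1, hD⟩ := exists_bound_iteratedFDeriv ψ.contDiffOn hK hKΩ k
  refine ⟨k.factorial * D ^ k, by positivity, fun g hg x hx C hC => ?_⟩
  have h := norm_iteratedFDerivWithin_comp_le hg ψ.contDiffOn (n := k)
    (by exact_mod_cast le_top) Ω.isOpen.uniqueDiffOn Ω'.isOpen.uniqueDiffOn ψ.mapsTo (hKΩ hx)
    (C := C) (D := D)
    (fun i hi => by
      rw [iteratedFDerivWithin_of_isOpen i Ω.isOpen (ψ.mapsTo x (hKΩ hx))]
      exact hC i hi)
    (fun i hi1 hi => by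
      rw [iteratedFDerivWithin_of_isOpen i Ω'.isOpen (hKΩ hx)]
      exact (hD i hi x hx).trans (le_self_pow₀ hD1 (by omega)))
  rw [iteratedFDerivWithin_of_isOpen k Ω'.isOpen (hKΩ hx)] at h
  exact h.trans_eq (by ring)

lemma isCompact_image {K : Set (Euc d)} (hK : IsCompact K) (hKΩ : K ⊆ Ω') :
    IsCompact (ψ.toFun '' K) :=
  hK.image_of_continuousOn (ψ.contDiffOn.continuousOn.mono hKΩ)

lemma image_subset {K : Set (Euc d)} (hKΩ : K ⊆ Ω') : ψ.toFun '' K ⊆ Ω := by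
  rintro _ ⟨x, hx, rfl⟩
  exact ψ.mapsTo x (hKΩ hx)

lemma exists_bound_fnComp {K : Set (Euc d)} (hK : IsCompact K) (hKΩ : K ⊆ Ω') (k : ℕ) :
    ∃ D : ℝ, 0 ≤ D ∧ ∀ f : smoothFn Ω, ∀ x ∈ K,
      ‖iteratedFDeriv ℝ k (fnExt (fnComp ψ f)) x‖ ≤
        (∑ i ∈ Finset.range (k + 1), ‖iteratedFDeriv ℝ i (fnExt f) (ψ.toFun x)‖) * D := by
  obtain ⟨D, hD0, hD⟩ := norm_iteratedFDeriv_comp_diffeo_le (F := ℂ) ψ hK hKΩ k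
  refine ⟨D, hD0, fun f x hx => ?_⟩
  have h1 : fnExt (fnComp ψ f) =ᶠ[𝓝 x] fnExt f ∘ ψ.toFun :=
    (zeroExt_comp_eqOn ψ f.1).eventuallyEq_of_mem (Ω'.isOpen.mem_nhds (hKΩ hx))
  rw [(h1.iteratedFDeriv ℝ k).eq_of_nhds, mul_comm]
  refine hD _ (fnExt_contDiffOn f) x hx _ fun i hi => ?_
  exact Finset.single_le_sum (f := fun i => ‖iteratedFDeriv ℝ i (fnExt f) (ψ.toFun x)‖)
    (fun j _ => norm_nonneg _) (by simp; omega)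

variable [NeZero d] {𝒰 : DirectingUltrafilter d}

lemma fnComp_moderate (f : moderateFn Ω 𝒰) : (fun φ => fnComp ψ (f.1 φ)) ∈ moderateFn Ω' 𝒰 := by
  refine isModerate_iff.2 fun K hK hKΩ k => ?_
  obtain ⟨D, hD0, hD⟩ := exists_bound_fnComp ψ hK hKΩ k
  refine (((ModOn.sum (Finset.range (k + 1)) fun i _ => ?_).mul (ModOn.const D)
    fun _ _ => hD0)).mono fun φ x hx => hD (f.1 φ) x hx
  obtain ⟨m, hm⟩ := isModerate_iff.1 f.2 _ (isCompact_image ψ hK hKΩ) (image_subset ψ hKΩ) i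
  exact ⟨m, hm.mono fun φ hφ x hx => hφ _ (mem_image_of_mem _ hx)⟩

lemma fnComp_negligible {f : TestFn d → smoothFn Ω} (hf : IsNegligible 𝒰 f) :
    IsNegligible 𝒰 fun φ => fnComp ψ (f φ) := by
  refine isNegligible_iff.2 fun K hK hKΩ k => ?_
  obtain ⟨D, hD0, hD⟩ := exists_bound_fnComp ψ hK hKΩ k
  refine (NegOn.const_mul D hD0 (NegOn.sum (Finset.range (k + 1)) fun i _ => ?_)).mono
    fun φ x hx => hD (f φ) x hx
  intro p
  exact (isNegligible_iff.1 hf _ (isCompact_image ψ hK hKΩ) (image_subset ψ hKΩ) i p).mono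
    fun φ hφ x hx => hφ _ (mem_image_of_mem _ hx)

/-- The composition `F ∘ ψ` of an asymptotic function on `Ω` with a diffeomorphism `ψ : Ω' → Ω`: the
class of the net `φ ↦ f_φ ∘ ψ`. -/
def asymComp (F : AsymFn Ω 𝒰) : AsymFn Ω' 𝒰 :=
  Quotient.liftOn' F
    (fun f => Ideal.Quotient.mk (negligibleFn Ω' 𝒰)
      ⟨fun φ => fnComp ψ (f.1 φ), fnComp_moderate ψ f⟩)
    (by
      intro f g hfg
      have h : f - g ∈ negligibleFn Ω 𝒰 := (Submodule.quotientRel_def _).1 hfg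
      refine Ideal.Quotient.eq.2 ?_
      exact fnComp_negligible ψ (f := fun φ => f.1 φ - g.1 φ) h)

end Diffeo
/-! ### Change of variables for distributions -/

section DistrComp

variable {d : ℕ} {Ω' Ω : Opens (Euc d)} (ψ : Diffeo Ω' Ω)

/-- The inverse of a diffeomorphism. -/
def Diffeo.symm : Diffeo Ω Ω' where
  toFun := ψ.invFun
  invFun := ψ.toFun
  mapsTo := ψ.mapsTo_inv
  mapsTo_inv := ψ.mapsTo
  left_inv := ψ.right_inv
  right_inv := ψ.left_inv
  contDiffOn := ψ.contDiffOn_inv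
  contDiffOn_inv := ψ.contDiffOn

lemma contDiff_det : ContDiff ℝ ∞ fun A : Euc d →L[ℝ] Euc d => A.det := by
  have h : ∀ A : Euc d →L[ℝ] Euc d, A.det = ∑ σ : Equiv.Perm (Fin d), (Equiv.Perm.sign σ : ℤ) •
      ∏ i, (A (EuclideanSpace.single i (1 : ℝ))) (σ i) := by
    intro A
    rw [ContinuousLinearMap.det,
      ← LinearMap.det_toMatrix (EuclideanSpace.basisFun (Fin d) ℝ).toBasis, Matrix.det_apply]
    refine Finset.sum_congr rfl fun σ _ => ?_
    simp [LinearMap.toMatrix_apply, Units.smul_def]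
  simp_rw [h]
  refine ContDiff.sum fun σ _ => ?_
  refine ContDiff.const_smul _ (contDiff_prod fun i _ => ?_)
  have h2 : ContDiff ℝ ∞ fun A : Euc d →L[ℝ] Euc d => A (EuclideanSpace.single i (1 : ℝ)) :=
    contDiff_id.clm_apply contDiff_const
  exact contDiff_euclidean.1 h2 (σ i)

/-- The Jacobian factor `|det Dψ⁻¹|`. -/
def jacobian (y : Euc d) : ℂ := ((|(fderiv ℝ ψ.invFun y).det| : ℝ) : ℂ)

lemma det_fderiv_inv_ne_zero {y : Euc d} (hy : y ∈ Ω) : (fderiv ℝ ψ.invFun y).det ≠ 0 := by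
  have h1 : HasFDerivAt ψ.invFun (fderiv ℝ ψ.invFun y) y :=
    ((ψ.contDiffOn_inv.contDiffAt (Ω.isOpen.mem_nhds hy)).differentiableAt (by simp)).hasFDerivAt
  have h2 : HasFDerivAt ψ.toFun (fderiv ℝ ψ.toFun (ψ.invFun y)) (ψ.invFun y) :=
    ((ψ.contDiffOn.contDiffAt (Ω'.isOpen.mem_nhds (ψ.mapsTo_inv y hy))).differentiableAt
      (by simp)).hasFDerivAt
  have h3 := h2.comp y h1
  have h4 : ψ.toFun ∘ ψ.invFun =ᶠ[𝓝 y] id := by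
    filter_upwards [Ω.isOpen.mem_nhds hy] with z hz using ψ.right_inv z hz
  have h5 := (h3.congr_of_eventuallyEq h4.symm).unique (hasFDerivAt_id y)
  intro h0
  have h6 : ((fderiv ℝ ψ.toFun (ψ.invFun y)).comp (fderiv ℝ ψ.invFun y)).det = 1 := by
    rw [h5, ContinuousLinearMap.det]
    simp
  rw [ContinuousLinearMap.det, ContinuousLinearMap.toLinearMap_comp, LinearMap.det_comp] at h6
  rw [ContinuousLinearMap.det] at h0
  simp [h0] at h6

lemma contDiffOn_jacobian : ContDiffOn ℝ ∞ (jacobian ψ) Ω := by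
  have h1 : ContDiffOn ℝ ∞ (fun y => (fderiv ℝ ψ.invFun y).det) Ω :=
    contDiff_det.comp_contDiffOn (ψ.contDiffOn_inv.fderiv_of_isOpen Ω.isOpen (by simp))
  have h2 : ContDiffOn ℝ ∞ (fun y => |(fderiv ℝ ψ.invFun y).det|) Ω := fun y hy =>
    (h1 y hy).abs (det_fderiv_inv_ne_zero ψ hy)
  exact Complex.ofRealCLM.contDiff.comp_contDiffOn h2

open scoped Classical in
/-- The function `|det Dψ⁻¹| · (τ ∘ ψ⁻¹)` on `Ω`, extended by zero. -/
def transportFn (τ : Euc d → ℂ) (y : Euc d) : ℂ :=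
  if y ∈ Ω then jacobian ψ y * τ (ψ.invFun y) else 0

lemma transportFn_eqOn (τ : Euc d → ℂ) :
    EqOn (transportFn ψ τ) (fun y => jacobian ψ y * (τ ∘ ψ.invFun) y) Ω := fun y hy => by
  have hy' : y ∈ Ω := hy
  simp [transportFn, hy']

lemma transportFn_eq_zero {τ : Euc d → ℂ} {K : Set (Euc d)} (hτ : ∀ x ∉ K, τ x = 0) {y : Euc d}
    (hy : y ∉ ψ.toFun '' K) : transportFn ψ τ y = 0 := by
  rw [transportFn]
  split_ifs with h
  · have : ψ.invFun y ∉ K := fun hK => hy ⟨_, hK, ψ.right_inv y h⟩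
    rw [hτ _ this, mul_zero]
  · rfl

lemma contDiff_transportFn {τ : Euc d → ℂ} (hτ : ContDiff ℝ ∞ τ) {K : Set (Euc d)}
    (hK : IsCompact K) (hKΩ : K ⊆ Ω') (h0 : ∀ x ∉ K, τ x = 0) :
    ContDiff ℝ ∞ (transportFn ψ τ) := by
  refine contDiff_iff_contDiffAt.2 fun y => ?_
  by_cases hy : y ∈ Ω
  · have h := ((contDiffOn_jacobian ψ).mul (hτ.comp_contDiffOn ψ.contDiffOn_inv)).congr
      (transportFn_eqOn ψ τ)
    exact h.contDiffAt (Ω.isOpen.mem_nhds hy)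
  · have h1 : y ∈ (ψ.toFun '' K)ᶜ := fun h => hy (image_subset ψ hKΩ h)
    have h2 : transportFn ψ τ =ᶠ[𝓝 y] fun _ => 0 := by
      filter_upwards [(isCompact_image ψ hK hKΩ).isClosed.isOpen_compl.mem_nhds h1] with z hz
      exact transportFn_eq_zero ψ h0 hz
    exact contDiffAt_const.congr_of_eventuallyEq h2

lemma exists_bound_transportFn {K : Set (Euc d)} (hK : IsCompact K) (hKΩ : K ⊆ Ω) (k : ℕ) :
    ∃ D : ℝ, 0 ≤ D ∧ ∀ τ : Euc d → ℂ, ContDiff ℝ ∞ τ → ∀ y ∈ K, ∀ C : ℝ,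
      (∀ i ≤ k, ∀ x, ‖iteratedFDeriv ℝ i τ x‖ ≤ C) →
        ‖iteratedFDeriv ℝ k (transportFn ψ τ) y‖ ≤ D * C := by
  obtain ⟨J, hJ1, hJ⟩ := exists_bound_iteratedFDeriv (contDiffOn_jacobian ψ) hK hKΩ k
  choose D hD0 hD using fun i =>
    norm_iteratedFDeriv_comp_diffeo_le (F := ℂ) ψ.symm hK hKΩ i
  refine ⟨∑ i ∈ Finset.range (k + 1), (k.choose i : ℝ) * J * D (k - i), ?_, ?_⟩
  · exact Finset.sum_nonneg fun i _ => by have := hD0 (k - i); positivity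
  intro τ hτ y hy C hC
  have hC0 : 0 ≤ C := (norm_nonneg _).trans (hC 0 (Nat.zero_le _) 0)
  have h1 : transportFn ψ τ =ᶠ[𝓝 y] fun y => jacobian ψ y * (τ ∘ ψ.invFun) y :=
    (transportFn_eqOn ψ τ).eventuallyEq_of_mem (Ω.isOpen.mem_nhds (hKΩ hy))
  rw [(h1.iteratedFDeriv ℝ k).eq_of_nhds]
  have h := norm_iteratedFDerivWithin_mul_le (contDiffOn_jacobian ψ)
    (hτ.comp_contDiffOn ψ.contDiffOn_inv) Ω.isOpen.uniqueDiffOn (hKΩ hy)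
    (n := k) (by exact_mod_cast le_top)
  simp only [iteratedFDerivWithin_of_isOpen _ Ω.isOpen (hKΩ hy)] at h
  refine h.trans ?_
  rw [Finset.sum_mul]
  refine Finset.sum_le_sum fun i hi => ?_
  have hi' : i ≤ k := by simp at hi; omega
  have h2 : ‖iteratedFDeriv ℝ (k - i) (τ ∘ ψ.invFun) y‖ ≤ D (k - i) * C :=
    hD (k - i) τ hτ.contDiffOn y hy C fun j hj => hC j (by omega) _
  calc (k.choose i : ℝ) * ‖iteratedFDeriv ℝ i (jacobian ψ) y‖ *
        ‖iteratedFDeriv ℝ (k - i) (τ ∘ ψ.invFun) y‖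
      ≤ (k.choose i : ℝ) * J * (D (k - i) * C) := by
        have := hJ i hi' y hy
        gcongr
    _ = _ := by ring

/-- The test function `|det Dψ⁻¹| · (τ ∘ ψ⁻¹)` on `Ω`. -/
def transport (τ : 𝓓(Ω', ℂ)) : 𝓓(Ω, ℂ) where
  toFun := transportFn ψ τ
  contDiff' := contDiff_transportFn ψ τ.contDiff τ.hasCompactSupport τ.tsupport_subset
    fun _ hx => image_eq_zero_of_notMem_tsupport hx
  hasCompactSupport' := HasCompactSupport.intro
    (isCompact_image ψ τ.hasCompactSupport τ.tsupport_subset) fun _ hy =>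
      transportFn_eq_zero ψ (fun _ hx => image_eq_zero_of_notMem_tsupport hx) hy
  tsupport_subset' := by
    have hc := isCompact_image ψ τ.hasCompactSupport τ.tsupport_subset
    refine (closure_minimal ?_ hc.isClosed).trans (image_subset ψ τ.tsupport_subset)
    intro y hy
    by_contra h
    exact hy (transportFn_eq_zero ψ (fun _ hx => image_eq_zero_of_notMem_tsupport hx) h)

/-- `transport` on the functions supported in a fixed compact set is continuous. -/
def transportSupportedIn (K : Compacts (Euc d)) (hK : (K : Set (Euc d)) ⊆ Ω') :
    𝓓^{⊤}_{K}(Euc d, ℂ) →L[ℂ]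
      𝓓^{⊤}_{⟨ψ.toFun '' K, isCompact_image ψ K.isCompact hK⟩}(Euc d, ℂ) :=
  ContDiffMapSupportedIn.mkCLM ℂ (fun τ => transportFn ψ τ)
    (by
      intro f g y
      simp only [transportFn]
      split_ifs
      · change _ * (f _ + g _) = _
        ring
      · simp)
    (by
      intro c f y
      simp only [transportFn]
      split_ifs
      · change _ * (c * f _) = c * _
        ring
      · simp)
    (fun f => contDiff_transportFn ψ f.contDiff K.isCompact hK f.zero_on_compl)
    (fun f y hy => transportFn_eq_zero ψ f.zero_on_compl hy)
    (by
      intro i _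
      obtain ⟨D, hD0, hD⟩ :=
        exists_bound_transportFn ψ (isCompact_image ψ K.isCompact hK) (image_subset ψ hK) i
      refine ⟨Finset.range (i + 1), D, hD0, fun f y hy => hD f f.contDiff y hy _ fun j hj x => ?_⟩
      refine (ContDiffMapSupportedIn.norm_iteratedFDeriv_apply_le_seminorm_top ℂ).trans ?_
      exact Seminorm.le_finset_sup_apply (Finset.mem_range.2 (by omega)))

/-- `transport` as a continuous linear map `𝓓(Ω') → 𝓓(Ω)`. -/
def transportCLM : 𝓓(Ω', ℂ) →L[ℂ] 𝓓(Ω, ℂ) :=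
  TestFunction.limitCLM ℂ (transport ψ)
    (fun K hK => (TestFunction.ofSupportedInCLM ℂ
      (K := ⟨ψ.toFun '' K, isCompact_image ψ K.isCompact hK⟩) (image_subset ψ hK)).comp
        (transportSupportedIn ψ K hK))
    (fun _ _ _ => rfl)

/-- The composition `T ∘ ψ` of a distribution on `Ω` with a diffeomorphism `ψ : Ω' → Ω`:
`(T ∘ ψ | τ) = (T | |det Dψ⁻¹| · (τ ∘ ψ⁻¹))`. -/
def distrComp (T : Distr Ω) : Distr Ω' := T.comp (transportCLM ψ)

end DistrComp
/-! ### The cut-off net and the regularization of distributions -/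

section Cutoff

variable {d : ℕ} (Ω : Opens (Euc d))

/-- The set `{x ∈ Ω | d(x, ∂Ω) > 2 R_φ, ‖x‖ < 1 / R_φ}`. The distance to the empty set is `∞`. -/
def cutSet (φ : TestFn d) : Set (Euc d) :=
  {x | x ∈ Ω ∧ ENNReal.ofReal (2 * radius φ) < Metric.infEDist x (frontier (Ω : Set (Euc d))) ∧
    ‖x‖ < 1 / radius φ}

/-- The cut-off function `C_{Ω,φ} = χ ⋆ φ`, with `χ` the indicator function of `cutSet Ω φ`. -/
def cutoffFn (φ : TestFn d) (x : Euc d) : ℂ := ∫ t in cutSet Ω φ, φ (x - t)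

lemma isOpen_cutSet (φ : TestFn d) : IsOpen (cutSet Ω φ) :=
  Ω.isOpen.inter ((isOpen_lt continuous_const Metric.continuous_infEDist).inter
    (isOpen_lt continuous_norm continuous_const))

lemma contDiff_cutoffFn (φ : TestFn d) : ContDiff ℝ ∞ (cutoffFn Ω φ) := by
  have h1 : LocallyIntegrable ((cutSet Ω φ).indicator fun _ => (1 : ℂ)) (volume : Measure (Euc d)) :=
    (locallyIntegrable_const (1 : ℂ)).indicator (isOpen_cutSet Ω φ).measurableSet
  have h2 := φ.hasCompactSupport.contDiff_convolution_right (ContinuousLinearMap.mul ℝ ℂ) h1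
    (μ := volume) (n := ⊤) φ.contDiff
  convert h2 using 1
  ext x
  rw [cutoffFn, convolution, ← integral_indicator (isOpen_cutSet Ω φ).measurableSet]
  congr 1
  ext t
  by_cases ht : t ∈ cutSet Ω φ <;> simp [ht]

variable {Ω} in
lemma mem_of_dist_lt {s x : Euc d} {r : ℝ} (hs : s ∈ closure (Ω : Set (Euc d)))
    (hr : ENNReal.ofReal r ≤ Metric.infEDist s (frontier (Ω : Set (Euc d)))) (hx : dist s x < r) :
    x ∈ Ω := by
  by_contra hxΩ
  have hr0 : 0 < r := dist_nonneg.trans_lt hx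
  have hsΩ : s ∈ (Ω : Set (Euc d)) := by
    by_contra h
    have : s ∈ frontier (Ω : Set (Euc d)) := by
      rw [Ω.isOpen.frontier_eq]
      exact ⟨hs, h⟩
    rw [Metric.infEDist_zero_of_mem this] at hr
    simp at hr
    linarith
  have h1 : (segment ℝ s x ∩ frontier (Ω : Set (Euc d))).Nonempty := by
    by_contra hne
    have hpre : IsPreconnected (segment ℝ s x) := (convex_segment s x).isPreconnected
    have hsub : segment ℝ s x ⊆ (Ω : Set (Euc d)) ∪ (closure (Ω : Set (Euc d)))ᶜ := by
      intro z hz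
      by_cases hzΩ : z ∈ (Ω : Set (Euc d))
      · exact Or.inl hzΩ
      · refine Or.inr fun hzc => hne ⟨z, hz, ?_⟩
        rw [Ω.isOpen.frontier_eq]
        exact ⟨hzc, hzΩ⟩
    have hx2 : x ∈ (closure (Ω : Set (Euc d)))ᶜ :=
      (hsub (right_mem_segment ℝ s x)).resolve_left hxΩ
    obtain ⟨z, -, hz1, hz2⟩ := hpre _ _ Ω.isOpen isClosed_closure.isOpen_compl hsub
      ⟨s, left_mem_segment ℝ s x, hsΩ⟩ ⟨x, right_mem_segment ℝ s x, hx2⟩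
    exact hz2 (subset_closure hz1)
  obtain ⟨z, hz, hzf⟩ := h1
  have h2 : dist s z ≤ dist s x := by
    rw [dist_comm s z, dist_comm s x]
    obtain ⟨a, b, ha, hb, hab, rfl⟩ := hz
    rw [dist_eq_norm, dist_eq_norm]
    have : a • s + b • x - s = b • (x - s) := by
      rw [← sub_eq_zero]
      have ha' : a = 1 - b := by linarith
      rw [ha']
      module
    rw [this, norm_smul, Real.norm_of_nonneg hb]
    exact mul_le_of_le_one_left (norm_nonneg _) (by linarith)
  have h3 : ENNReal.ofReal r ≤ edist s z := hr.trans (Metric.infEDist_le_edist_of_mem hzf)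
  rw [edist_dist] at h3
  have := (ENNReal.ofReal_le_ofReal_iff dist_nonneg).1 h3
  linarith

variable [NeZero d]

variable {Ω} in
open scoped Pointwise in
/-- A compact subset of `Ω` that contains the support of the cut-off function. -/
lemma exists_compact_cutoffFn (φ : TestFn d) :
    ∃ A : Set (Euc d), IsCompact A ∧ A ⊆ Ω ∧ ∀ x ∉ A, cutoffFn Ω φ x = 0 := by
  have hR := radius_pos φ
  have hb : Bornology.IsBounded (cutSet Ω φ) :=
    isBounded_iff_forall_norm_le.2 ⟨1 / radius φ, fun x hx => hx.2.2.le⟩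
  have hc : IsCompact (closure (cutSet Ω φ)) := hb.isCompact_closure
  refine ⟨closure (cutSet Ω φ) + Metric.closedBall 0 (radius φ),
    hc.add (isCompact_closedBall _ _), ?_, ?_⟩
  · rintro _ ⟨s, hs, y, hy, rfl⟩
    have h1 : closure (cutSet Ω φ) ⊆ {s | s ∈ closure (Ω : Set (Euc d)) ∧
        ENNReal.ofReal (2 * radius φ) ≤ Metric.infEDist s (frontier (Ω : Set (Euc d)))} := by
      refine closure_minimal (fun s hs => ⟨subset_closure hs.1, hs.2.1.le⟩) ?_
      exact isClosed_closure.inter (isClosed_le continuous_const Metric.continuous_infEDist)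
    refine mem_of_dist_lt (h1 hs).1 (h1 hs).2 ?_
    simp only [mem_closedBall_zero_iff] at hy
    simp
    linarith
  · intro x hx
    rw [cutoffFn]
    refine (setIntegral_congr_fun (isOpen_cutSet Ω φ).measurableSet (g := fun _ => 0) ?_).trans
      (by simp)
    intro t ht
    by_contra h
    refine hx ⟨t, subset_closure ht, x - t, ?_, by simp⟩
    simpa using norm_le_radius φ h

/-- The cut-off function `C_{Ω,φ}` as a test function on `Ω`. -/
def cutoff (φ : TestFn d) : 𝓓(Ω, ℂ) where
  toFun := cutoffFn Ω φ
  contDiff' := contDiff_cutoffFn Ω φ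
  hasCompactSupport' := by
    obtain ⟨A, hA, -, h0⟩ := exists_compact_cutoffFn (Ω := Ω) φ
    exact HasCompactSupport.intro hA h0
  tsupport_subset' := by
    obtain ⟨A, hA, hAΩ, h0⟩ := exists_compact_cutoffFn (Ω := Ω) φ
    refine (closure_minimal ?_ hA.isClosed).trans hAΩ
    intro x hx
    by_contra h
    exact hx (h0 x h)

variable {Ω}

/-- Near a compact subset of `Ω` the cut-off function is almost everywhere equal to `1`. -/
lemma cutoff_eq_one (𝒰 : DirectingUltrafilter d) {K : Set (Euc d)} (hK : IsCompact K)
    (hKΩ : K ⊆ Ω) : ∀ᶠ φ in 𝒰.ae, ∀ x ∈ K, ∀ t, ‖x - t‖ ≤ radius φ → cutoff Ω φ t = 1 := by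
  obtain ⟨δ, hδ, hδΩ⟩ := hK.exists_cthickening_subset_open Ω.isOpen hKΩ
  obtain ⟨C, hC⟩ := hK.isBounded.exists_norm_le
  filter_upwards [ae_radius_lt 𝒰 (show 0 < δ / 4 by positivity), ae_radius_lt 𝒰 one_pos,
    ae_le_inv_radius 𝒰 (C + 3), ae_isDirecting 𝒰 1 le_rfl] with φ h1 h2 h3 h4 x hx t ht
  have hR := radius_pos φ
  have hmem : ∀ s, ‖t - s‖ ≤ radius φ → s ∈ cutSet Ω φ := by
    intro s hs
    have hxs : dist s x ≤ 2 * radius φ := by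
      rw [dist_comm, dist_eq_norm]
      calc ‖x - s‖ = ‖(x - t) + (t - s)‖ := by rw [sub_add_sub_cancel]
        _ ≤ _ := (norm_add_le _ _).trans (by linarith)
    refine ⟨hδΩ (Metric.mem_cthickening_of_dist_le s x δ K hx (by linarith)), ?_, ?_⟩
    · refine lt_of_lt_of_le (b := ENNReal.ofReal (δ - 2 * radius φ)) ?_ ?_
      · exact (ENNReal.ofReal_lt_ofReal_iff (by linarith)).2 (by linarith)
      · refine Metric.le_infEDist.2 fun z hz => ?_
        rw [edist_dist]
        refine ENNReal.ofReal_le_ofReal ?_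
        by_contra hlt
        push Not at hlt
        rw [Ω.isOpen.frontier_eq] at hz
        refine hz.2 (hδΩ (Metric.mem_cthickening_of_dist_le z x δ K hx ?_))
        have := dist_triangle_left z x s
        linarith
    · have h5 : ‖s‖ ≤ ‖x‖ + dist s x := by
        rw [dist_eq_norm]
        calc ‖s‖ = ‖x + (s - x)‖ := by simp
          _ ≤ _ := norm_add_le _ _
      have := hC x hx
      rw [one_div]
      linarith
  change cutoffFn Ω φ t = 1
  rw [cutoffFn, setIntegral_eq_integral_of_forall_compl_eq_zero, integral_sub_left_eq_self φ,
    h4.integral_eq_one]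
  intro s hs
  by_contra h
  exact hs (hmem s (norm_le_radius φ h))

end Cutoff
/-! ### Smoothness of the regularization -/

section Regularization

variable {d : ℕ} {Ω : Opens (Euc d)}

/-- The test function `t ↦ η(t) g(x - t)`. -/
def shiftMul (η : 𝓓(Ω, ℂ)) (g : Euc d → ℂ) (hg : ContDiff ℝ ∞ g) (x : Euc d) : 𝓓(Ω, ℂ) where
  toFun t := η t * g (x - t)
  contDiff' := η.contDiff.mul (hg.comp (contDiff_const.sub contDiff_id))
  hasCompactSupport' := η.hasCompactSupport.mul_right
  tsupport_subset' := (closure_mono (Function.support_mul_subset_left _ _)).trans η.tsupport_subset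

/-- A distribution has finite order on a compact set. -/
lemma exists_bound_distr (T : Distr Ω) {K : Set (Euc d)} (hK : IsCompact K) (hKΩ : K ⊆ Ω) :
    ∃ (b : ℕ) (C : ℝ), 0 ≤ C ∧ ∀ f : 𝓓(Ω, ℂ), (∀ x ∉ K, f x = 0) → ∀ B : ℝ, 0 ≤ B →
      (∀ i ≤ b, ∀ x ∈ K, ‖iteratedFDeriv ℝ i f x‖ ≤ B) → ‖T f‖ ≤ C * B := by
  set K' : Compacts (Euc d) := ⟨K, hK⟩
  have hK' : (K' : Set (Euc d)) ⊆ Ω := hKΩ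
  let S : 𝓓^{⊤}_{K'}(Euc d, ℂ) →L[ℂ] ℂ := T.comp (TestFunction.ofSupportedInCLM ℂ hK')
  let q : Seminorm ℂ 𝓓^{⊤}_{K'}(Euc d, ℂ) := (normSeminorm ℂ ℂ).comp S.toLinearMap
  have hq : Continuous q := continuous_norm.comp S.continuous
  obtain ⟨s, C, -, hC⟩ := Seminorm.bound_of_continuous
    (ContDiffMapSupportedIn.withSeminorms ℂ (Euc d) ℂ ⊤ K') q hq
  refine ⟨s.sup id, C, C.2, fun f hf B hB h => ?_⟩
  let f' : 𝓓^{⊤}_{K'}(Euc d, ℂ) := ⟨f, f.contDiff, hf⟩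
  have h1 : ‖T f‖ ≤ C * (s.sup fun i => N[ℂ; ℂ]_{K', ⊤, i}) f' := hC f'
  refine h1.trans (mul_le_mul_of_nonneg_left ?_ C.2)
  refine Seminorm.finset_sup_apply_le hB fun i hi => ?_
  refine (ContDiffMapSupportedIn.seminorm_top_le_iff ℂ hB i f').2 fun x hx => ?_
  exact h i (Finset.le_sup (f := id) hi) x hx

lemma norm_iteratedFDeriv_comp_const_sub {E : Type} [NormedAddCommGroup E] [NormedSpace ℝ E]
    (g : E → ℂ) (k : ℕ) (x t : E) :
    ‖iteratedFDeriv ℝ k (fun t => g (x - t)) t‖ = ‖iteratedFDeriv ℝ k g (x - t)‖ := by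
  have h1 : (fun t => g (x - t)) = fun t => (fun u => g (-u)) (t - x) := by
    ext t; simp
  rw [h1, iteratedFDeriv_comp_sub (f := fun u => g (-u))]
  have h2 := (LinearIsometryEquiv.neg ℝ (E := E)).norm_iteratedFDeriv_comp_right g (t - x) k
  rw [show (x - t) = -(t - x) by simp]
  exact h2

/-- The second order remainder of a smooth function and all its derivatives. -/
lemma exists_bound_remainder {E : Type} [NormedAddCommGroup E] [NormedSpace ℝ E] [ProperSpace E]
    {R : ℝ} (k : ℕ) : ∀ {F : Type} [NormedAddCommGroup F]
    [NormedSpace ℝ F] (g : E → F), ContDiff ℝ ∞ g → ∃ C : ℝ, 0 ≤ C ∧ ∀ h : E, ‖h‖ ≤ 1 →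
      ∀ u : E, ‖u‖ ≤ R →
        ‖iteratedFDeriv ℝ k (fun u => g (u + h) - g u - fderiv ℝ g u h) u‖ ≤ C * ‖h‖ ^ 2 := by
  induction k with
  | zero =>
    intro F _ _ g hg
    have hg' : ContDiff ℝ ∞ (fderiv ℝ g) := hg.fderiv_right (by simp)
    have hg'' : Continuous (fderiv ℝ (fderiv ℝ g)) := (hg'.fderiv_right (m := ∞) (by simp)).continuous
    obtain ⟨C, hC⟩ := (isCompact_closedBall (0 : E) (R + 1)).exists_bound_of_continuousOn
      (f := fderiv ℝ (fderiv ℝ g)) hg''.continuousOn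
    refine ⟨max C 0, le_max_right _ _, fun h hh u hu => ?_⟩
    rw [norm_iteratedFDeriv_zero]
    have hball : ∀ z ∈ Metric.closedBall u ‖h‖, z ∈ Metric.closedBall (0 : E) (R + 1) := by
      intro z hz
      rw [mem_closedBall_iff_norm] at hz
      rw [mem_closedBall_zero_iff]
      calc ‖z‖ = ‖(z - u) + u‖ := by simp
        _ ≤ _ := (norm_add_le _ _).trans (by linarith)
    have h1 : ∀ z ∈ Metric.closedBall u ‖h‖, ‖fderiv ℝ g z - fderiv ℝ g u‖ ≤ max C 0 * ‖h‖ := by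
      intro z hz
      have := (convex_closedBall u ‖h‖).norm_image_sub_le_of_norm_fderiv_le (𝕜 := ℝ)
        (f := fderiv ℝ g) (C := max C 0)
        (fun y _ => (hg'.differentiable (by simp)).differentiableAt)
        (fun y hy => (hC y (hball y hy)).trans (le_max_left _ _))
        (Metric.mem_closedBall_self (norm_nonneg h)) hz
      refine this.trans (mul_le_mul_of_nonneg_left ?_ (le_max_right _ _))
      exact mem_closedBall_iff_norm.1 hz
    have h2 := (convex_closedBall u ‖h‖).norm_image_sub_le_of_norm_fderiv_le' (𝕜 := ℝ)
      (f := g) (C := max C 0 * ‖h‖) (φ := fderiv ℝ g u)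
      (fun y _ => (hg.differentiable (by simp)).differentiableAt) h1
      (Metric.mem_closedBall_self (norm_nonneg h)) (y := u + h) (by simp)
    rw [add_sub_cancel_left] at h2
    exact h2.trans_eq (by ring)
  | succ k ih =>
    intro F _ _ g hg
    have hg' : ContDiff ℝ ∞ (fderiv ℝ g) := hg.fderiv_right (by simp)
    obtain ⟨C, hC0, hC⟩ := ih (fderiv ℝ g) hg'
    refine ⟨C, hC0, fun h hh u hu => ?_⟩
    rw [← norm_iteratedFDeriv_fderiv]
    have h1 : fderiv ℝ (fun u => g (u + h) - g u - fderiv ℝ g u h) =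
        fun u => fderiv ℝ g (u + h) - fderiv ℝ g u - fderiv ℝ (fderiv ℝ g) u h := by
      ext1 u
      have hd : Differentiable ℝ g := hg.differentiable (by simp)
      have hd' : Differentiable ℝ (fderiv ℝ g) := hg'.differentiable (by simp)
      have e1 : HasFDerivAt (fun u => g (u + h)) (fderiv ℝ g (u + h)) u := by
        exact (hasFDerivAt_comp_add_right h).2 (hd (u + h)).hasFDerivAt
      have e2 : HasFDerivAt (fun u => fderiv ℝ g u h) ((fderiv ℝ (fderiv ℝ g) u).flip h) u := by
        have := (hd' u).hasFDerivAt.clm_apply (hasFDerivAt_const h u)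
        simpa using this
      refine ((e1.sub (hd u).hasFDerivAt).sub e2).fderiv.trans ?_
      congr 1
      ext v
      exact (hg.contDiffAt.isSymmSndFDerivAt (by simpa using ENat.LEInfty.out)).eq v h
    rw [h1]
    exact hC h hh u hu

lemma hasFDerivAt_apply_shiftMul (T : Distr Ω) (η : 𝓓(Ω, ℂ)) {g : Euc d → ℂ}
    (hg : ContDiff ℝ ∞ g) (x : Euc d) : HasFDerivAt (fun x => T (shiftMul η g hg x))
      (∑ i : Fin d, (EuclideanSpace.proj i : Euc d →L[ℝ] ℝ).smulRight
        (T (shiftMul η (fun u => fderiv ℝ g u (EuclideanSpace.single i 1))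
          ((hg.fderiv_right (by simp)).clm_apply contDiff_const) x))) x := by
  have hg' : ContDiff ℝ ∞ (fderiv ℝ g) := hg.fderiv_right (by simp)
  have hr : ∀ h : Euc d, ContDiff ℝ ∞ fun u => g (u + h) - g u - fderiv ℝ g u h := fun h =>
    ((hg.comp (contDiff_id.add contDiff_const)).sub hg).sub (hg'.clm_apply contDiff_const)
  obtain ⟨b, C, hC0, hC⟩ := exists_bound_distr T η.hasCompactSupport η.tsupport_subset
  obtain ⟨R0, hR0⟩ := η.hasCompactSupport.isBounded.exists_norm_le
  choose D hD0 hD using fun k => exists_bound_remainder (R := ‖x‖ + R0) k g hg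
  obtain ⟨M, hM1, hM⟩ := exists_bound_iteratedFDeriv (Ω' := ⊤) (g := η) η.contDiff.contDiffOn
    η.hasCompactSupport (fun _ _ => trivial) b
  set A : ℝ := ∑ k ∈ Finset.range (b + 1), ∑ i ∈ Finset.range (k + 1),
    (k.choose i : ℝ) * M * D (k - i)
  have hA0 : 0 ≤ A := Finset.sum_nonneg fun k _ => Finset.sum_nonneg fun i _ => by
    have := hD0 (k - i); positivity
  have key : ∀ h : Euc d, ‖h‖ ≤ 1 → ‖T (shiftMul η _ (hr h) x)‖ ≤ C * (A * ‖h‖ ^ 2) := by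
    intro h hh
    refine hC _ (fun t ht => ?_) _ (by positivity) fun k hk t ht => ?_
    · change η t * _ = 0
      rw [image_eq_zero_of_notMem_tsupport ht, zero_mul]
    have h1 := norm_iteratedFDeriv_mul_le η.contDiff
      ((hr h).comp (contDiff_const.sub contDiff_id : ContDiff ℝ ∞ fun t => x - t)) t (n := k)
      (by exact_mod_cast le_top)
    refine h1.trans ?_
    refine le_trans (b := (∑ i ∈ Finset.range (k + 1), (k.choose i : ℝ) * M * D (k - i)) *
      ‖h‖ ^ 2) ?_ ?_
    · rw [Finset.sum_mul]
      refine Finset.sum_le_sum fun i hi => ?_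
      have hi' : i ≤ k := by simp at hi; omega
      have h2 : ‖iteratedFDeriv ℝ (k - i)
          ((fun u => g (u + h) - g u - fderiv ℝ g u h) ∘ fun t => x - t) t‖ ≤
            D (k - i) * ‖h‖ ^ 2 := by
        have h3 := norm_iteratedFDeriv_comp_const_sub
          (fun u => g (u + h) - g u - fderiv ℝ g u h) (k - i) x t
        refine h3.trans_le (hD (k - i) h hh _ ?_)
        exact (norm_sub_le _ _).trans (by have := hR0 t ht; linarith)
      have h4 := hM i (by omega) t ht
      calc _ ≤ (k.choose i : ℝ) * M * (D (k - i) * ‖h‖ ^ 2) := by gcongr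
        _ = _ := by ring
    · refine mul_le_mul_of_nonneg_right ?_ (by positivity)
      refine Finset.single_le_sum (f := fun k => ∑ i ∈ Finset.range (k + 1),
        (k.choose i : ℝ) * M * D (k - i)) (fun k _ => Finset.sum_nonneg fun i _ => ?_)
          (Finset.mem_range.2 (by omega))
      have := hD0 (k - i)
      positivity
  have hlin : ∀ h : Euc d, T (shiftMul η _ (hr h) x) = T (shiftMul η g hg (x + h)) -
      T (shiftMul η g hg x) - (∑ i : Fin d, (EuclideanSpace.proj i : Euc d →L[ℝ] ℝ).smulRight
        (T (shiftMul η (fun u => fderiv ℝ g u (EuclideanSpace.single i 1))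
          ((hg.fderiv_right (by simp)).clm_apply contDiff_const) x))) h := by
    intro h
    have e1 : shiftMul η _ (hr h) x = shiftMul η g hg (x + h) - shiftMul η g hg x -
        ∑ i : Fin d, (h i : ℂ) • (shiftMul η (fun u => fderiv ℝ g u (EuclideanSpace.single i 1))
          ((hg.fderiv_right (by simp)).clm_apply contDiff_const) x) := by
      ext t
      have e2 : fderiv ℝ g (x - t) h =
          ∑ i : Fin d, (h i : ℂ) * fderiv ℝ g (x - t) (EuclideanSpace.single i 1) := by
        have e3 : h = ∑ i : Fin d, h i • EuclideanSpace.single i (1 : ℝ) := by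
          ext j
          simp [Finset.sum_apply, Pi.single_apply]
        conv_lhs => rw [e3]
        rw [map_sum]
        simp
      have e4 : ∀ (s : Finset (Fin d)) (v : Fin d → 𝓓(Ω, ℂ)),
          (∑ i ∈ s, v i) t = ∑ i ∈ s, v i t := by
        intro s v
        classical
        induction s using Finset.induction_on with
        | empty => rfl
        | insert i s hi ih =>
          rw [Finset.sum_insert hi, Finset.sum_insert hi, ← ih]
          rfl
      change η t * (g (x - t + h) - g (x - t) - fderiv ℝ g (x - t) h) =
        η t * g (x + h - t) - η t * g (x - t) - _
      rw [e4, e2, sub_add_eq_add_sub, mul_sub, mul_sub, Finset.mul_sum]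
      congr 1
      refine Finset.sum_congr rfl fun i _ => ?_
      change _ = (h i : ℂ) * (η t * _)
      ring
    rw [e1, map_sub, map_sub, map_sum]
    simp
  rw [hasFDerivAt_iff_isLittleO_nhds_zero]
  refine Asymptotics.IsBigO.trans_isLittleO (g := fun h : Euc d => ‖h‖ ^ 2) ?_ ?_
  · refine Asymptotics.IsBigO.of_bound (C * A) ?_
    filter_upwards [Metric.closedBall_mem_nhds (0 : Euc d) one_pos] with h hh
    rw [← hlin h]
    refine (key h (by simpa using hh)).trans_eq ?_
    simp
    ring
  · simpa using (Asymptotics.isLittleO_norm_pow_id (E' := Euc d) (n := 2) (by norm_num))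

lemma contDiff_apply_shiftMul (T : Distr Ω) (η : 𝓓(Ω, ℂ)) (n : ℕ) : ∀ {g : Euc d → ℂ}
    (hg : ContDiff ℝ ∞ g), ContDiff ℝ n (fun x => T (shiftMul η g hg x)) := by
  induction n with
  | zero =>
    intro g hg
    refine contDiff_zero.2 (continuous_iff_continuousAt.2 fun x => ?_)
    exact (hasFDerivAt_apply_shiftMul T η hg x).continuousAt
  | succ n ih =>
    intro g hg
    have hg' : ContDiff ℝ ∞ (fderiv ℝ g) := hg.fderiv_right (by simp)
    have hd := fun x => hasFDerivAt_apply_shiftMul T η hg x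
    rw [Nat.cast_add, Nat.cast_one, contDiff_succ_iff_fderiv]
    refine ⟨fun x => (hd x).differentiableAt, fun h => absurd h (WithTop.natCast_ne_top n), ?_⟩
    have : fderiv ℝ (fun x => T (shiftMul η g hg x)) = _ := funext fun x => (hd x).fderiv
    rw [this]
    refine ContDiff.sum fun i _ => ?_
    exact ((ContinuousLinearMap.smulRightL ℝ (Euc d) ℂ (EuclideanSpace.proj i)).contDiff).comp
      (ih (hg'.clm_apply contDiff_const))

lemma contDiff_infty_apply_shiftMul (T : Distr Ω) (η : 𝓓(Ω, ℂ)) {g : Euc d → ℂ}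
    (hg : ContDiff ℝ ∞ g) : ContDiff ℝ ∞ (fun x => T (shiftMul η g hg x)) :=
  contDiff_infty.2 fun n => contDiff_apply_shiftMul T η n hg

lemma pderiv_succ {f : Euc d → ℂ} (hf : ContDiff ℝ ∞ f) {k : ℕ} (I : Fin (k + 1) → Fin d)
    (x : Euc d) : pderiv I f x = pderiv (fun j => I j.castSucc)
      (fun y => fderiv ℝ f y (EuclideanSpace.single (I (Fin.last k)) 1)) x := by
  rw [pderiv, pderiv, iteratedFDeriv_succ_apply_right]
  have hf' : ContDiff ℝ ∞ (fderiv ℝ f) := hf.fderiv_right (by simp)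
  have h := (ContinuousLinearMap.apply ℝ ℂ
    (EuclideanSpace.single (I (Fin.last k)) (1 : ℝ))).iteratedFDeriv_comp_left
      (f := fderiv ℝ f) (x := x) (n := ∞) hf'.contDiffAt (i := k) (by exact_mod_cast le_top)
  have h2 := congrArg (fun M => M fun j => EuclideanSpace.single (I j.castSucc) (1 : ℝ)) h
  exact h2.symm

lemma contDiff_pderiv {f : Euc d → ℂ} (hf : ContDiff ℝ ∞ f) {k : ℕ} (I : Fin k → Fin d) :
    ContDiff ℝ ∞ (pderiv I f) := by
  have h : ContDiff ℝ ∞ (iteratedFDeriv ℝ k f) := hf.iteratedFDeriv_right (by exact_mod_cast le_top)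
  exact (ContinuousMultilinearMap.apply ℝ (fun _ : Fin k => Euc d) ℂ
    (fun j => EuclideanSpace.single (I j) (1 : ℝ))).contDiff.comp h

lemma pderiv_apply_shiftMul (T : Distr Ω) (η : 𝓓(Ω, ℂ)) (k : ℕ) : ∀ {g : Euc d → ℂ}
    (hg : ContDiff ℝ ∞ g) (I : Fin k → Fin d) (x : Euc d),
      pderiv I (fun x => T (shiftMul η g hg x)) x =
        T (shiftMul η (pderiv I g) (contDiff_pderiv hg I) x) := by
  induction k with
  | zero =>
    intro g hg I x
    simp only [pderiv, iteratedFDeriv_zero_apply]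
    congr 1
  | succ k ih =>
    intro g hg I x
    rw [pderiv_succ (contDiff_infty_apply_shiftMul T η hg)]
    have h1 : (fun y => fderiv ℝ (fun x => T (shiftMul η g hg x)) y
        (EuclideanSpace.single (I (Fin.last k)) 1)) = fun y =>
          T (shiftMul η (fun u => fderiv ℝ g u (EuclideanSpace.single (I (Fin.last k)) 1))
            ((hg.fderiv_right (by simp)).clm_apply contDiff_const) y) := by
      ext y
      rw [(hasFDerivAt_apply_shiftMul T η hg y).fderiv]
      simp
    rw [h1, ih]
    congr 2
    ext y
    exact (pderiv_succ hg I y).symm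

lemma norm_iteratedFDeriv_pderiv_le {g : Euc d → ℂ} (hg : ContDiff ℝ ∞ g) {k : ℕ}
    (I : Fin k → Fin d) (j : ℕ) (x : Euc d) :
    ‖iteratedFDeriv ℝ j (pderiv I g) x‖ ≤ ‖iteratedFDeriv ℝ (k + j) g x‖ := by
  induction k generalizing g j with
  | zero =>
    have : pderiv I g = g := by
      ext y
      simp [pderiv]
    rw [this, Nat.zero_add]
  | succ k ih =>
    have hg' : ContDiff ℝ ∞ (fderiv ℝ g) := hg.fderiv_right (by simp)
    have h1 : pderiv I g = pderiv (fun j => I j.castSucc)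
        (fun y => fderiv ℝ g y (EuclideanSpace.single (I (Fin.last k)) 1)) :=
      funext fun y => pderiv_succ hg I y
    rw [h1]
    refine (ih (hg'.clm_apply contDiff_const) _ j).trans ?_
    have h2 := (ContinuousLinearMap.apply ℝ ℂ
      (EuclideanSpace.single (I (Fin.last k)) (1 : ℝ))).norm_iteratedFDeriv_comp_left
        (f := fderiv ℝ g) (x := x) (N := ∞) hg'.contDiffAt (n := k + j) (by exact_mod_cast le_top)
    refine h2.trans ?_
    rw [norm_iteratedFDeriv_fderiv, show k + 1 + j = k + j + 1 by ring]
    refine mul_le_of_le_one_left (norm_nonneg _) ?_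
    refine ContinuousLinearMap.opNorm_le_bound _ zero_le_one fun A => ?_
    simpa using A.le_opNorm (EuclideanSpace.single (I (Fin.last k)) (1 : ℝ))

end Regularization
/-! ### The embedding of the distributions -/

section Embedding

variable {d : ℕ} [NeZero d] {Ω : Opens (Euc d)}

/-- The `φ`-regularization `T ⊛ φ = (C_{Ω,φ} T) ⋆ φ` on `Ω`, that is
`(T ⊛ φ)(x) = (T(t) | C_{Ω,φ}(t) φ(x - t))`. -/
def regularization (T : Distr Ω) (φ : TestFn d) : smoothFn Ω :=
  ⟨fun x => T (shiftMul (cutoff Ω φ) φ φ.contDiff x),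
    (contDiff_infty_apply_shiftMul T (cutoff Ω φ) φ.contDiff).contDiffOn.congr
      (zeroExt_eqOn fun _ => rfl)⟩

lemma pderiv_regularization (T : Distr Ω) (φ : TestFn d) {k : ℕ} (I : Fin k → Fin d) {x : Euc d}
    (hx : x ∈ Ω) : pderiv I (fnExt (regularization T φ)) x =
      T (shiftMul (cutoff Ω φ) (pderiv I φ) (contDiff_pderiv φ.contDiff I) x) := by
  have h : fnExt (regularization T φ) =ᶠ[𝓝 x]
      fun x => T (shiftMul (cutoff Ω φ) φ φ.contDiff x) :=
    zeroExt_eventuallyEq (g := fun x => T (shiftMul (cutoff Ω φ) φ φ.contDiff x))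
      (fun _ => rfl) hx
  rw [← pderiv_apply_shiftMul T (cutoff Ω φ) k φ.contDiff I x, pderiv, pderiv,
    (h.iteratedFDeriv ℝ k).eq_of_nhds]

lemma pderiv_eq_zero {φ : TestFn d} {k : ℕ} (I : Fin k → Fin d) {x : Euc d}
    (hx : radius φ < ‖x‖) : pderiv I φ x = 0 := by
  have h : (φ : Euc d → ℂ) =ᶠ[𝓝 x] fun _ => 0 := by
    filter_upwards [(isOpen_lt continuous_const continuous_norm).mem_nhds hx] with y hy
    by_contra h0
    exact absurd (norm_le_radius φ h0) (not_le.2 hy)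
  rw [pderiv, (h.iteratedFDeriv ℝ k).eq_of_nhds]
  change iteratedFDeriv ℝ k (0 : Euc d → ℂ) x _ = 0
  simp

/-- The regularization of a distribution is a moderate net. -/
lemma regularization_moderate (𝒰 : DirectingUltrafilter d) (T : Distr Ω) :
    regularization T ∈ moderateFn Ω 𝒰 := by
  intro K hK hKΩ k I
  obtain ⟨δ, hδ, hδΩ⟩ := hK.exists_cthickening_subset_open Ω.isOpen hKΩ
  obtain ⟨b, C, hC0, hC⟩ := exists_bound_distr T (hK.cthickening (r := δ)) hδΩ
  let P : TestFn d → Unit → ℝ := fun φ _ => C * ∑ j ∈ Finset.range (b + 1),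
    ∑ _J : Fin (k + j) → Fin d, ((radius φ)⁻¹) ^ (2 * (k + j + d))
  have hP : ModOn 𝒰 univ P := by
    refine (ModOn.const C).mul (ModOn.sum _ fun j _ => ModOn.sum _ fun J _ =>
      ⟨2 * (k + j + d), Eventually.of_forall fun φ _ _ => le_rfl⟩) fun φ _ => ?_
    exact Finset.sum_nonneg fun j _ => Finset.sum_nonneg fun _ _ =>
      pow_nonneg (inv_nonneg.2 (radius_pos φ).le) _
  obtain ⟨m, hm⟩ := hP
  refine ⟨m, ?_⟩
  filter_upwards [hm, cutoff_eq_one 𝒰 hK hKΩ, ae_radius_lt 𝒰 hδ,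
    ae_isDirecting 𝒰 (k + b + 1) (by omega)] with φ h1 h2 h3 h4 x hx
  refine le_trans ?_ (h1 () trivial)
  have hR := radius_pos φ
  rw [pderiv_regularization T φ I (hKΩ hx)]
  have hfun : ∀ t, shiftMul (cutoff Ω φ) (pderiv I φ) (contDiff_pderiv φ.contDiff I) x t =
      pderiv I φ (x - t) := by
    intro t
    change cutoff Ω φ t * pderiv I φ (x - t) = _
    by_cases ht : ‖x - t‖ ≤ radius φ
    · rw [h2 x hx t ht, one_mul]
    · rw [pderiv_eq_zero I (not_le.1 ht), mul_zero]
  have hB : 0 ≤ ∑ j ∈ Finset.range (b + 1),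
      ∑ _J : Fin (k + j) → Fin d, ((radius φ)⁻¹) ^ (2 * (k + j + d)) :=
    Finset.sum_nonneg fun j _ => Finset.sum_nonneg fun _ _ => pow_nonneg (inv_nonneg.2 hR.le) _
  refine hC _ (fun t ht => ?_) _ hB fun j hj t _ => ?_
  · rw [hfun]
    refine pderiv_eq_zero I ?_
    by_contra hle
    push Not at hle
    refine ht (Metric.mem_cthickening_of_dist_le t x δ K hx ?_)
    rw [dist_comm, dist_eq_norm]
    linarith
  · have hfun' : (shiftMul (cutoff Ω φ) (pderiv I φ) (contDiff_pderiv φ.contDiff I) x :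
        Euc d → ℂ) = fun t => pderiv I φ (x - t) := funext hfun
    rw [hfun', norm_iteratedFDeriv_comp_const_sub]
    refine (norm_iteratedFDeriv_pderiv_le φ.contDiff I j _).trans ?_
    refine (norm_iteratedFDeriv_le_sum_pderiv (k + j) _ _).trans ?_
    refine (Finset.sum_le_sum fun J _ => h4.derivatives_le (k + j) (by omega) J (x - t)).trans ?_
    exact Finset.single_le_sum (f := fun j => ∑ _J : Fin (k + j) → Fin d,
      ((radius φ)⁻¹) ^ (2 * (k + j + d))) 
      (fun i _ => Finset.sum_nonneg fun _ _ => pow_nonneg (inv_nonneg.2 hR.le) _)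
      (Finset.mem_range.2 (by omega))

/-- The embedding `E_Ω` of the distributions on `Ω` into the asymptotic functions on `Ω`: the class
of the net `φ ↦ T ⊛ φ`. -/
def embed (𝒰 : DirectingUltrafilter d) (T : Distr Ω) : AsymFn Ω 𝒰 :=
  Ideal.Quotient.mk (negligibleFn Ω 𝒰) ⟨regularization T, regularization_moderate 𝒰 T⟩

end Embedding

end AsymptoticFunctions

end

open MeasureTheory TopologicalSpace Filter Set
open scoped Distributions ContDiff Topology

namespace AsymptoticFunctions

/-! ### Calculus of partial derivatives -/

section PartialDerivatives

variable {d : ℕ}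

/-! Both pairings differ by a negligible net from one and the same complex number, the value of `T`
at `transport ψ τ`, that is at |det Dψ⁻¹| (τ ∘ ψ⁻¹). The two regularizations are never compared
pointwise, and the mollifier φ is never transported by ψ.

The main fact is `negligible_fnPairing_regularization_sub`: for any distribution S and any test
function σ, the net (S ⊛ φ | σ) − (S | σ) is negligible. For small R_φ the cut-off equals 1 wherever
φ(x − t) ≠ 0 with x in the support of σ, so the pairing is the integral over x of S applied to t ↦
σ(x) φ(x − t). Taking the integral inside S gives S applied to the mollification t ↦ ∫ φ(x − t) σ(x)
dx. On a compact neighbourhood of the support S has some finite order b, so it suffices to compare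
the partial derivatives of order at most b of this mollification with those of σ. Integration by
parts (`integral_pderiv_comp_sub_mul`) turns the former into mollifications of the derivatives of σ,
and Taylor expansion together with the vanishing moments
(`IsDirecting.norm_integral_comp_sub_mul_sub_le`) bounds the error by a constant times R_φ^(n+1).
Almost every φ lies in each 𝓓_n, so n may be chosen as large as a prescribed power of R_φ requires.

The interchange of S with the integral (`exists_bound_integral_sub`) takes place in a Banach space:
by Hahn–Banach, S restricted to test functions supported in K factors through their jets in a finite
product of copies of C(K), where Bochner integrals commute with continuous functionals.

Finally (f ∘ ψ | τ) = (f | `transport ψ τ`) exactly for smooth f (`fnPairing_fnComp`), while T ∘ ψ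
satisfies the same formula by definition. Applying the main fact to T with `transport ψ τ`, and to T
∘ ψ with τ, gives the theorem. -/

lemma pderiv_fderiv_comm {k : ℕ} : ∀ {f : Euc d → ℂ}, ContDiff ℝ ∞ f →
    ∀ (I : Fin k → Fin d) (v x : Euc d),
      pderiv I (fun y => fderiv ℝ f y v) x = fderiv ℝ (pderiv I f) x v := by
  induction k with
  | zero =>
    intro f _ I v x
    have : pderiv I f = f := by
      ext y
      simp [pderiv]
    rw [this]
    simp [pderiv]
  | succ k ih =>
    intro f hf I v x
    have hf' : ContDiff ℝ ∞ (fderiv ℝ f) := hf.fderiv_right (by simp)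
    set w := EuclideanSpace.single (I (Fin.last k)) (1 : ℝ)
    have hd : ∀ u y z : Euc d,
        fderiv ℝ (fun y => fderiv ℝ f y u) y z = fderiv ℝ (fderiv ℝ f) y z u := by
      intro u y z
      have := ((hf'.differentiable (by simp)) y).hasFDerivAt.clm_apply (hasFDerivAt_const u y)
      rw [this.fderiv]
      simp
    -- Symmetry of the second derivative takes `v` past the innermost direction `w`; the induction
    -- hypothesis, applied to the derivative of `f` along `w`, takes it past the other `k`.
    have h1 : (fun y => fderiv ℝ (fun y => fderiv ℝ f y v) y w) =
        fun y => fderiv ℝ (fun y => fderiv ℝ f y w) y v := by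
      ext y
      rw [hd, hd]
      exact (hf.contDiffAt.isSymmSndFDerivAt (by simpa using ENat.LEInfty.out)).eq w v
    rw [pderiv_succ (hf'.clm_apply contDiff_const), h1, ih (hf'.clm_apply contDiff_const)]
    congr 2
    ext y
    exact (pderiv_succ hf I y).symm

lemma pderiv_const_mul {f : Euc d → ℂ} (hf : ContDiff ℝ ∞ f) {k : ℕ} (I : Fin k → Fin d)
    (c : ℂ) (x : Euc d) : pderiv I (fun y => c * f y) x = c * pderiv I f x := by
  have h := iteratedFDeriv_const_smul_apply (a := c) (i := k)
    ((hf.contDiffAt (x := x)).of_le (by exact_mod_cast le_top))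
  exact congrArg (fun M => M fun j => EuclideanSpace.single (I j) (1 : ℝ)) h

lemma pderiv_add {f g : Euc d → ℂ} (hf : ContDiff ℝ ∞ f) (hg : ContDiff ℝ ∞ g) {k : ℕ}
    (I : Fin k → Fin d) (x : Euc d) :
    pderiv I (fun y => f y + g y) x = pderiv I f x + pderiv I g x := by
  have h := iteratedFDeriv_add_apply (i := k)
    ((hf.contDiffAt (x := x)).of_le (by exact_mod_cast le_top))
    ((hg.contDiffAt (x := x)).of_le (by exact_mod_cast le_top))
  exact congrArg (fun M => M fun j => EuclideanSpace.single (I j) (1 : ℝ)) h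

/-- By the chain rule each derivative in the subtracted variable costs a factor −1. Integration by
parts produces the same sign again, and the two cancel in `integral_pderiv_comp_sub_mul`. -/
lemma pderiv_comp_const_sub {k : ℕ} : ∀ {f : Euc d → ℂ}, ContDiff ℝ ∞ f →
    ∀ (I : Fin k → Fin d) (x t : Euc d),
      pderiv I (fun s => f (x - s)) t = (-1) ^ k * pderiv I f (x - t) := by
  induction k with
  | zero => intro f _ I x t; simp [pderiv]
  | succ k ih =>
    intro f hf I x t
    have hf' : ContDiff ℝ ∞ (fderiv ℝ f) := hf.fderiv_right (by simp)
    set v := EuclideanSpace.single (I (Fin.last k)) (1 : ℝ)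
    have hfv : ContDiff ℝ ∞ fun y => fderiv ℝ f y v := hf'.clm_apply contDiff_const
    have hs : ContDiff ℝ ∞ fun s => f (x - s) := hf.comp (contDiff_const.sub contDiff_id)
    rw [pderiv_succ hs, pderiv_succ hf]
    have h1 : (fun y => fderiv ℝ (fun s => f (x - s)) y v) =
        fun y => (-1 : ℂ) * fderiv ℝ f (x - y) v := by
      ext y
      have h := ((hf.differentiable (by simp) (x - y)).hasFDerivAt.comp y
        ((hasFDerivAt_id y).const_sub x)).fderiv
      refine (congrArg (fun A => A v) h).trans ?_
      simp
    rw [h1, pderiv_const_mul (f := fun y => fderiv ℝ f (x - y) v)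
      (hfv.comp (contDiff_const.sub contDiff_id)), ih hfv]
    ring

lemma pderiv_of_notMem_tsupport {f : Euc d → ℂ} {k : ℕ} (I : Fin k → Fin d) {x : Euc d}
    (hx : x ∉ tsupport f) : pderiv I f x = 0 := by
  rw [pderiv, image_eq_zero_of_notMem_tsupport
    fun h => hx (tsupport_iteratedFDeriv_subset k h)]
  rfl

lemma hasCompactSupport_pderiv {f : Euc d → ℂ} (hf : HasCompactSupport f) {k : ℕ}
    (I : Fin k → Fin d) : HasCompactSupport (pderiv I f) :=
  HasCompactSupport.intro hf fun _ hx => pderiv_of_notMem_tsupport I hx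

/-- Repeated integration by parts in a convolution integral. -/
lemma integral_pderiv_comp_sub_mul {k : ℕ} : ∀ {f g : Euc d → ℂ}, ContDiff ℝ ∞ f →
    ContDiff ℝ ∞ g → HasCompactSupport g → ∀ (I : Fin k → Fin d) (t : Euc d),
      ∫ x, (-1) ^ k * pderiv I f (x - t) * g x = ∫ x, f (x - t) * pderiv I g x := by
  induction k with
  | zero => intro f g _ _ _ I t; simp [pderiv]
  | succ k ih =>
    intro f g hf hg hgc I t
    have hf' : ContDiff ℝ ∞ (fderiv ℝ f) := hf.fderiv_right (by simp)
    have hg' : ContDiff ℝ ∞ (fderiv ℝ g) := hg.fderiv_right (by simp)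
    set v := EuclideanSpace.single (I (Fin.last k)) (1 : ℝ)
    set J : Fin k → Fin d := fun j => I j.castSucc
    have hfv : ContDiff ℝ ∞ fun y => fderiv ℝ f y v := hf'.clm_apply contDiff_const
    have hgJ : ContDiff ℝ ∞ (pderiv J g) := contDiff_pderiv hg J
    have hgJc : HasCompactSupport (pderiv J g) := hasCompactSupport_pderiv hgc J
    have hsub : ContDiff ℝ ∞ fun x : Euc d => x - t := contDiff_id.sub contDiff_const
    have h1 : ∀ x, (-1 : ℂ) ^ (k + 1) * pderiv I f (x - t) * g x =
        -((-1) ^ k * pderiv J (fun y => fderiv ℝ f y v) (x - t) * g x) := by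
      intro x
      rw [pderiv_succ hf I]
      ring
    -- `pderiv_succ` puts the last direction innermost; it has to be outermost on `g` for a single
    -- integration by parts to remove it.
    have h2 : ∀ x, f (x - t) * pderiv I g x =
        f (x - t) * fderiv ℝ (pderiv J g) x v := by
      intro x
      rw [pderiv_succ hg I, pderiv_fderiv_comm hg]
    have hgJ' : ContDiff ℝ ∞ fun x => fderiv ℝ (pderiv J g) x v :=
      (hgJ.fderiv_right (m := ∞) (by simp)).clm_apply contDiff_const
    simp_rw [h1, h2, integral_neg]
    -- The induction hypothesis for the derivative of `f` along `v` moves the first `k` derivatives,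
    -- and one more integration by parts moves the last. The integrability conditions hold because
    -- every integrand contains `pderiv J g` or a derivative of it, which has compact support.
    rw [ih hfv hg hgc J t, integral_mul_fderiv_eq_neg_fderiv_mul_of_integrable
      (f := fun x => f (x - t)) (g := pderiv J g)]
    · congr 2
      ext x
      rw [fderiv_comp_sub]
    · refine Continuous.integrable_of_hasCompactSupport ?_ hgJc.mul_left
      simp_rw [fderiv_comp_sub]
      exact (hfv.comp hsub).continuous.mul hgJ.continuous
    · exact ((hf.comp hsub).continuous.mul hgJ'.continuous).integrable_of_hasCompactSupport
        (hgJc.fderiv_apply ℝ v).mul_left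
    · exact ((hf.comp hsub).continuous.mul hgJ.continuous).integrable_of_hasCompactSupport
        hgJc.mul_left
    · exact fun x _ => (hf.comp hsub).differentiable (by simp) x
    · exact fun x _ => hgJ.differentiable (by simp) x

end PartialDerivatives

/-! ### Mollification by functions with vanishing moments -/

section Moments

variable {d : ℕ}

/-- Expanding every argument in the standard basis shows that a Taylor term is a combination of
monomials in `u`, whose integrals against φ are moments. -/
lemma iteratedFDeriv_apply_diag (g : Euc d → ℂ) (k : ℕ) (t u : Euc d) :
    iteratedFDeriv ℝ k g t (fun _ => u) =
      ∑ I : Fin k → Fin d, ((∏ j, u (I j) : ℝ) : ℂ) * pderiv I g t := by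
  have hu : (fun _ : Fin k => u) =
      fun _ => ∑ i : Fin d, u i • EuclideanSpace.single i (1 : ℝ) := by
    ext j i
    simp [Finset.sum_apply, Pi.single_apply]
  rw [hu]
  refine ((iteratedFDeriv ℝ k g t).map_sum
    (fun _ i => u i • EuclideanSpace.single i (1 : ℝ))).trans ?_
  refine Finset.sum_congr rfl fun I _ => ?_
  refine ((iteratedFDeriv ℝ k g t).map_smul_univ (fun j => u (I j))
    (fun j => EuclideanSpace.single (I j) (1 : ℝ))).trans ?_
  rw [Complex.real_smul]
  rfl

lemma integrable_continuous_mul (φ : TestFn d) {h : Euc d → ℂ} (hh : Continuous h) :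
    Integrable fun u => h u * φ u :=
  (hh.mul φ.continuous).integrable_of_hasCompactSupport φ.hasCompactSupport.mul_left

/-- The product is the monomial u^α in which α_i counts the positions where `I` takes the value i.
The fibres of `I` partition the `k` positions, so |α| = k lies in the range of the moment
conditions. -/
lemma IsDirecting.integral_prod_mul {n : ℕ} {φ : TestFn d} (hφ : IsDirecting n φ) {k : ℕ}
    (hk : 1 ≤ k) (hkn : k ≤ n) (I : Fin k → Fin d) :
    ∫ u, ((∏ j, u (I j) : ℝ) : ℂ) * φ u = 0 := by
  classical
  have hsum : ∑ i, (Finset.univ.filter fun j => I j = i).card = k := by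
    rw [← Finset.card_eq_sum_card_fiberwise (f := I) (t := Finset.univ) (by simp)]
    simp
  rw [← hφ.moments (fun i => (Finset.univ.filter fun j => I j = i).card) (hsum.symm ▸ hk)
    (hsum.symm ▸ hkn)]
  congr 2
  ext u
  congr 2
  rw [← Finset.prod_fiberwise Finset.univ I]
  refine Finset.prod_congr rfl fun i _ => ?_
  rw [Finset.prod_congr rfl (g := fun _ => u i)
    (by intro j hj; rw [(Finset.mem_filter.1 hj).2])]
  simp

lemma IsDirecting.integral_iteratedFDeriv_mul {n : ℕ} {φ : TestFn d} (hφ : IsDirecting n φ)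
    {k : ℕ} (hk : 1 ≤ k) (hkn : k ≤ n) (g : Euc d → ℂ) (t : Euc d) :
    ∫ u, iteratedFDeriv ℝ k g t (fun _ => u) * φ u = 0 := by
  simp_rw [iteratedFDeriv_apply_diag, Finset.sum_mul]
  rw [integral_finsetSum]
  · refine Finset.sum_eq_zero fun I _ => ?_
    simp_rw [mul_right_comm _ (pderiv I g t)]
    rw [integral_mul_const, hφ.integral_prod_mul hk hkn, zero_mul]
  · exact fun I _ => integrable_continuous_mul φ (by fun_prop)

/-- This is the integral form of the remainder along the segment from `t` to `t + u`. The factors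
1/n! and (1 − s)^n are both bounded by 1, since only the power of ‖u‖ matters later. -/
lemma norm_taylor_remainder_le {g : Euc d → ℂ} (hg : ContDiff ℝ ∞ g) {n : ℕ} {M : ℝ}
    (hM : ∀ x, ‖iteratedFDeriv ℝ (n + 1) g x‖ ≤ M) (t u : Euc d) :
    ‖g (t + u) - ∑ k ∈ Finset.range (n + 1),
      (k.factorial : ℝ)⁻¹ • iteratedFDeriv ℝ k g t (fun _ => u)‖ ≤ M * ‖u‖ ^ (n + 1) := by
  have hM0 : 0 ≤ M := (norm_nonneg _).trans (hM 0)
  rw [map_add_eq_sum_add_integral_iteratedFDeriv (n := n)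
    (fun s _ => hg.contDiffAt.of_le (by exact_mod_cast le_top)), add_sub_cancel_left, norm_smul]
  have h1 : ‖∫ s in (0 : ℝ)..1, (1 - s) ^ n •
      iteratedFDeriv ℝ (n + 1) g (t + s • u) (fun _ => u)‖ ≤ M * ‖u‖ ^ (n + 1) * |1 - 0| := by
    refine intervalIntegral.norm_integral_le_of_norm_le_const fun s hs => ?_
    rw [uIoc_of_le zero_le_one] at hs
    rw [norm_smul, norm_pow, Real.norm_of_nonneg (by linarith [hs.2])]
    have h2 : (1 - s) ^ n ≤ 1 := pow_le_one₀ (by linarith [hs.2]) (by linarith [hs.1])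
    have h3 : ‖iteratedFDeriv ℝ (n + 1) g (t + s • u) (fun _ => u)‖ ≤ M * ‖u‖ ^ (n + 1) := by
      refine (ContinuousMultilinearMap.le_opNorm _ _).trans ?_
      simpa using mul_le_mul_of_nonneg_right (hM (t + s • u)) (by positivity)
    calc _ ≤ 1 * (M * ‖u‖ ^ (n + 1)) := by
          have : 0 ≤ (1 - s) ^ n := pow_nonneg (by linarith [hs.2]) _
          gcongr
      _ = _ := one_mul _
  have h4 : ‖((n.factorial : ℝ)⁻¹)‖ ≤ 1 := by
    rw [norm_inv, Real.norm_natCast]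
    exact inv_le_one_of_one_le₀ (by exact_mod_cast n.factorial_pos)
  calc _ ≤ 1 * (M * ‖u‖ ^ (n + 1) * |1 - 0|) := by gcongr
    _ = _ := by simp

/-- Mollification with a function whose moments up to order `n` vanish approximates to order
`n + 1` in the radius of support. -/
lemma IsDirecting.norm_integral_comp_sub_mul_sub_le {n : ℕ} (hn : 1 ≤ n) {φ : TestFn d}
    (hφ : IsDirecting n φ) {g : Euc d → ℂ} (hg : ContDiff ℝ ∞ g) {M : ℝ}
    (hM : ∀ x, ‖iteratedFDeriv ℝ (n + 1) g x‖ ≤ M) (t : Euc d) :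
    ‖(∫ x, φ (x - t) * g x) - g t‖ ≤ M * radius φ ^ (n + 1) * 2 := by
  have hM0 : 0 ≤ M := (norm_nonneg _).trans (hM 0)
  set P : Euc d → ℂ := fun u => ∑ k ∈ Finset.range (n + 1),
    (k.factorial : ℝ)⁻¹ • iteratedFDeriv ℝ k g t (fun _ => u)
  have hk : ∀ k, Continuous fun u : Euc d =>
      (k.factorial : ℝ)⁻¹ • iteratedFDeriv ℝ k g t (fun _ => u) := by
    intro k
    have h : Continuous fun u : Euc d => iteratedFDeriv ℝ k g t (fun _ => u) :=
      (iteratedFDeriv ℝ k g t).coe_continuous.comp (continuous_pi fun _ => continuous_id)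
    fun_prop
  have hP : Continuous P := continuous_finsetSum _ fun k _ => hk k
  have hgt : Continuous fun u => g (t + u) :=
    hg.continuous.comp (continuous_const.add continuous_id)
  -- Substituting x = t + u centres the mollifier at the origin, where its moments are prescribed.
  have h1 : ∫ x, φ (x - t) * g x = ∫ u, g (t + u) * φ u := by
    rw [← integral_add_left_eq_self _ t]
    simp [mul_comm]
  -- The moment conditions annihilate the Taylor terms of orders 1 to n; the term of order 0 gives
  -- `g t` because φ has integral 1.
  have h2 : ∫ u, P u * φ u = g t := by
    simp only [P, Finset.sum_mul]
    rw [integral_finsetSum _ fun k _ => integrable_continuous_mul φ (hk k),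
      Finset.sum_range_succ', Finset.sum_eq_zero]
    · simp [integral_const_mul, hφ.integral_eq_one]
    · intro k hk'
      simp only [Finset.mem_range] at hk'
      simp_rw [smul_mul_assoc]
      rw [integral_smul, hφ.integral_iteratedFDeriv_mul (by omega) (by omega), smul_zero]
  rw [h1, ← h2, ← integral_sub (integrable_continuous_mul φ hgt) (integrable_continuous_mul φ hP)]
  have hi : Integrable fun u => ‖φ u‖ :=
    (φ.continuous.integrable_of_hasCompactSupport φ.hasCompactSupport).norm
  refine (norm_integral_le_of_norm_le (hi.const_mul (M * radius φ ^ (n + 1)))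
    (Eventually.of_forall fun u => ?_)).trans ?_
  · rw [← sub_mul, norm_mul]
    by_cases hu : φ u = 0
    · simp [hu]
    refine mul_le_mul_of_nonneg_right ?_ (norm_nonneg _)
    refine (norm_taylor_remainder_le hg hM t u).trans ?_
    have := norm_le_radius φ hu
    gcongr
  · rw [integral_const_mul]
    -- The factor 2 in the conclusion bounds the L¹ norm of φ, which is at most 1 + 1/n.
    have hn' : (1 : ℝ) ≤ n := by exact_mod_cast hn
    have h3 : (1 : ℝ) / n ≤ 1 := by rw [div_le_one (by linarith)]; exact hn'
    -- The case d = 0 is not excluded here, so `radius_pos` is unavailable; the radius is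
    -- nonnegative because φ, having integral 1, is nonzero somewhere.
    have hR : 0 ≤ M * radius φ ^ (n + 1) := by
      by_cases hex : ∃ u, φ u ≠ 0
      · obtain ⟨u, hu⟩ := hex
        have := (norm_nonneg u).trans (norm_le_radius φ hu)
        positivity
      · push Not at hex
        have := hφ.integral_eq_one
        simp [hex] at this
    exact mul_le_mul_of_nonneg_left (hφ.integral_norm_le.trans (by linarith)) hR

end Moments

/-! ### Distributions under the integral sign -/

section Interchange

variable {d : ℕ} {Ω : Opens (Euc d)}

/-- A linear functional that is bounded by the seminorm induced by a linear map into a normed space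
factors continuously through that map. -/
lemma exists_continuousLinearMap_factor {V W : Type*} [AddCommGroup V] [Module ℂ V]
    [SeminormedAddCommGroup W] [NormedSpace ℂ W] (j : V →ₗ[ℂ] W) (T : V →ₗ[ℂ] ℂ) {C : ℝ}
    (h : ∀ f, ‖T f‖ ≤ C * ‖j f‖) : ∃ L : W →L[ℂ] ℂ, ∀ f, L (j f) = T f := by
  -- The section `s` of `j` over its range is only linear, but `T ∘ s` is bounded by `C` since `j ∘
  -- s` is the identity there. Hahn–Banach then extends it to `W`.
  obtain ⟨s, hs⟩ := j.rangeRestrict.exists_rightInverse_of_surjective j.range_rangeRestrict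
  have hs' : ∀ y, j (s y) = y := fun y => congrArg Subtype.val (LinearMap.congr_fun hs y)
  obtain ⟨L, hL, -⟩ := exists_extension_norm_eq (LinearMap.range j)
    (LinearMap.mkContinuous (T ∘ₗ s) C fun y => by
      have := h (s y)
      rw [hs'] at this
      exact this)
  refine ⟨L, fun f => (hL (j.rangeRestrict f)).trans ?_⟩
  -- The vectors `f` and `s (j f)` have the same image under `j`, so the assumed bound forces `T` to
  -- agree on them.
  have h3 := h (f - s (j.rangeRestrict f))
  have h4 : j (f - s (j.rangeRestrict f)) = 0 := by
    rw [map_sub, hs']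
    exact sub_self _
  rw [h4, norm_zero, mul_zero, norm_le_zero_iff, map_sub, sub_eq_zero] at h3
  exact h3.symm

/-- The indices of the partial derivatives of order at most `b`. -/
abbrev DerivIndex (d b : ℕ) := Σ k : Fin (b + 1), Fin k → Fin d

/-- The test functions on `Ω` that vanish off `K`. -/
def supportedIn (Ω : Opens (Euc d)) (K : Set (Euc d)) : Submodule ℂ 𝓓(Ω, ℂ) where
  carrier := {f | ∀ x ∉ K, f x = 0}
  add_mem' := by
    intro f g hf hg x hx
    change f x + g x = 0
    rw [hf x hx, hg x hx, add_zero]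
  zero_mem' := fun _ _ => rfl
  smul_mem' := by
    intro c f hf x hx
    change c * f x = 0
    rw [hf x hx, mul_zero]

/-- The jet of order `b` on `K` of a test function. -/
noncomputable def jet (Ω : Opens (Euc d)) (K : Set (Euc d)) (b : ℕ) :
    𝓓(Ω, ℂ) →ₗ[ℂ] (DerivIndex d b → C(K, ℂ)) where
  toFun f I := ⟨fun t => pderiv I.2 f t,
    (contDiff_pderiv f.contDiff I.2).continuous.comp continuous_subtype_val⟩
  map_add' f g := by
    ext I t
    exact pderiv_add f.contDiff g.contDiff I.2 t
  map_smul' c f := by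
    ext I t
    exact pderiv_const_mul f.contDiff I.2 c t

/-- On the test functions supported in a compact set a distribution factors through the jets of
some order. -/
lemma exists_dual_jet (T : Distr Ω) {K : Set (Euc d)} [CompactSpace K] (hK : IsCompact K)
    (hKΩ : K ⊆ Ω) : ∃ (b : ℕ) (L : (DerivIndex d b → C(K, ℂ)) →L[ℂ] ℂ),
      ∀ f ∈ supportedIn Ω K, T f = L (jet Ω K b f) := by
  obtain ⟨b, C, hC0, hC⟩ := exists_bound_distr T hK hKΩ
  -- The operator norm of the `k`-th derivative is at most the sum of its d^k partial derivatives,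
  -- each bounded by the norm of the jet; summing the counts over k ≤ b gives one constant for all
  -- orders.
  set A : ℝ := ∑ k ∈ Finset.range (b + 1), (Fintype.card (Fin k → Fin d) : ℝ)
  have hbound : ∀ f ∈ supportedIn Ω K, ‖T f‖ ≤ C * A * ‖jet Ω K b f‖ := by
    intro f hf
    rw [mul_assoc]
    refine hC f hf _ (by positivity) fun k hk x hx => ?_
    refine (norm_iteratedFDeriv_le_sum_pderiv k f x).trans ?_
    have h1 : ∀ I : Fin k → Fin d, ‖pderiv I f x‖ ≤ ‖jet Ω K b f‖ := fun I =>
      ((jet Ω K b f ⟨⟨k, by omega⟩, I⟩).norm_coe_le_norm ⟨x, hx⟩).trans (norm_le_pi_norm _ _)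
    refine (Finset.sum_le_card_nsmul _ _ _ fun I _ => h1 I).trans ?_
    rw [nsmul_eq_mul]
    refine mul_le_mul_of_nonneg_right ?_ (norm_nonneg _)
    exact Finset.single_le_sum (f := fun k => (Fintype.card (Fin k → Fin d) : ℝ))
      (fun _ _ => by positivity) (Finset.mem_range.2 (by omega))
  obtain ⟨L, hL⟩ := exists_continuousLinearMap_factor
    ((jet Ω K b).domRestrict (supportedIn Ω K)) (T.toLinearMap.domRestrict (supportedIn Ω K))
    (fun f => hbound f.1 f.2)
  exact ⟨b, L, fun f hf => (hL ⟨f, hf⟩).symm⟩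

/-- The integral of a compactly supported continuous family of test functions, paired with a
distribution, is controlled by the integrals of the partial derivatives. -/
lemma exists_bound_integral_sub (T : Distr Ω) {K : Set (Euc d)} (hK : IsCompact K) (hKΩ : K ⊆ Ω) :
    ∃ (b : ℕ) (C : ℝ), 0 ≤ C ∧ ∀ (F : Euc d → 𝓓(Ω, ℂ)) (S : Set (Euc d)), IsCompact S →
      (∀ x ∉ S, F x = 0) → (∀ x, ∀ t ∉ K, F x t = 0) →
      (∀ (k : ℕ) (I : Fin k → Fin d),
        Continuous fun p : Euc d × Euc d => pderiv I (F p.1) p.2) →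
      ∀ f : 𝓓(Ω, ℂ), (∀ t ∉ K, f t = 0) → ∀ B : ℝ, 0 ≤ B →
      (∀ k ≤ b, ∀ (I : Fin k → Fin d), ∀ t ∈ K,
        ‖(∫ x, pderiv I (F x) t) - pderiv I f t‖ ≤ B) →
      ‖(∫ x, T (F x)) - T f‖ ≤ C * B := by
  have : CompactSpace K := isCompact_iff_compactSpace.1 hK
  obtain ⟨b, L, hL⟩ := exists_dual_jet T hK hKΩ
  refine ⟨b, ‖L‖, norm_nonneg _, fun F S hS hFS hFK hFc f hf B hB h => ?_⟩
  -- Joint continuity in (x, t) curries to continuity of x ↦ jet for the uniform norm on the compact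
  -- set `K`.
  have hc : Continuous fun x => jet Ω K b (F x) := by
    refine continuous_pi fun I => ContinuousMap.continuous_of_continuous_uncurry _ ?_
    exact (hFc I.1 I.2).comp (continuous_fst.prodMk (continuous_subtype_val.comp continuous_snd))
  have hcs : HasCompactSupport fun x => jet Ω K b (F x) :=
    HasCompactSupport.intro hS fun x hx => by rw [hFS x hx, map_zero]
  have hi : Integrable fun x => jet Ω K b (F x) := hc.integrable_of_hasCompactSupport hcs
  -- This is the interchange: the integral is formed among jets, so no integral with values in the
  -- space of test functions is needed.
  have h1 : ∫ x, T (F x) = L (∫ x, jet Ω K b (F x)) := by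
    rw [← L.integral_comp_comm hi]
    exact integral_congr_ae (Eventually.of_forall fun x => hL _ (hFK x))
  rw [h1, hL f hf, ← map_sub]
  refine (L.le_opNorm _).trans (mul_le_mul_of_nonneg_left ?_ (norm_nonneg _))
  refine (pi_norm_le_iff_of_nonneg hB).2 fun I => (ContinuousMap.norm_le _ hB).2 fun t => ?_
  -- Evaluation of a component at a point is continuous and linear, so the integral of the jets is
  -- computed derivative by derivative and point by point.
  let ev : (DerivIndex d b → C(K, ℂ)) →L[ℂ] ℂ :=
    (ContinuousMap.evalCLM ℂ t).comp (ContinuousLinearMap.proj I)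
  have h2 : (∫ x, jet Ω K b (F x)) I t = ∫ x, pderiv I.2 (F x) t :=
    (ev.integral_comp_comm hi).symm
  rw [Pi.sub_apply, ContinuousMap.sub_apply, h2]
  exact h I.1 (by omega) I.2 t t.2

end Interchange

/-! ### Weak association of a distribution and its image -/

section Association

variable {d : ℕ} [NeZero d] {Ω : Opens (Euc d)}

/-- Moving the scalar `τ x` inside `T` exhibits the pairing as an integral of `T` over a family of
test functions, the form treated by `exists_bound_integral_sub`. The integral may run over the whole
space because τ vanishes off Ω. -/
lemma fnPairing_regularization (T : Distr Ω) (φ : TestFn d) (τ : 𝓓(Ω, ℂ)) :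
    fnPairing τ (regularization T φ) =
      ∫ x, T (τ x • shiftMul (cutoff Ω φ) φ φ.contDiff x) := by
  have h : ∀ x ∈ Ω, fnExt (regularization T φ) x * τ x =
      T (τ x • shiftMul (cutoff Ω φ) φ φ.contDiff x) := by
    intro x hx
    rw [map_smul, smul_eq_mul, mul_comm]
    congr 1
    exact zeroExt_of_mem _ hx
  refine (setIntegral_congr_fun Ω.isOpen.measurableSet h).trans ?_
  refine setIntegral_eq_integral_of_forall_compl_eq_zero fun x hx => ?_
  rw [image_eq_zero_of_notMem_tsupport fun h => hx (τ.tsupport_subset h), zero_smul, map_zero]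

/-- On test functions the regularizations of a distribution differ from it by a negligible net. -/
lemma negligible_fnPairing_regularization_sub (𝒰 : DirectingUltrafilter d) (T : Distr Ω)
    (τ : 𝓓(Ω, ℂ)) (p : ℕ) :
    ∀ᶠ φ in 𝒰.ae, ‖fnPairing τ (regularization T φ) - T τ‖ < radius φ ^ p := by
  have hK := τ.hasCompactSupport
  have hKΩ := τ.tsupport_subset
  -- Once R_φ < δ, this thickening contains the support of t ↦ φ(x − t) for every x in the support
  -- of τ. The order `b` and the constant `C` of `T` on it are fixed before φ.
  obtain ⟨δ, hδ, hδΩ⟩ := hK.exists_cthickening_subset_open Ω.isOpen hKΩ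
  obtain ⟨b, C, hC0, hC⟩ := exists_bound_integral_sub T (hK.cthickening (r := δ)) hδΩ
  -- A Taylor remainder of order p + 2 will be taken of derivatives of τ of order at most b, so b +
  -- (p + 2) derivatives are needed.
  obtain ⟨M, hM1, hM⟩ := exists_bound_iteratedFDeriv (Ω' := ⊤) (g := τ) τ.contDiff.contDiffOn
    hK (fun _ _ => trivial) (b + (p + 2))
  have hM' : ∀ k ≤ b, ∀ (I : Fin k → Fin d) (x : Euc d),
      ‖iteratedFDeriv ℝ (p + 1 + 1) (pderiv I τ) x‖ ≤ M := by
    intro k hk I x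
    refine (norm_iteratedFDeriv_pderiv_le τ.contDiff I _ x).trans ?_
    by_cases hx : x ∈ tsupport τ
    · exact hM _ (by omega) x hx
    · rw [image_eq_zero_of_notMem_tsupport fun h => hx (tsupport_iteratedFDeriv_subset _ h),
        norm_zero]
      linarith
  -- Vanishing moments up to order p + 1 give an error of order R_φ^(p+2). One surplus power absorbs
  -- the constant C · 2M ≤ R_φ⁻¹, the other makes the inequality strict.
  filter_upwards [cutoff_eq_one 𝒰 hK hKΩ, ae_radius_lt 𝒰 hδ, ae_radius_lt 𝒰 one_pos,
    ae_isDirecting 𝒰 (p + 1) (by omega), ae_le_inv_radius 𝒰 (C * (M * 2))] with φ h1 h2 h3 h4 h5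
  have hR := radius_pos φ
  -- The cut-off disappears: it is 1 where both `τ x` and `φ (x - t)` are nonzero, and elsewhere the
  -- product vanishes anyway.
  have hF : ∀ x, ((τ x • shiftMul (cutoff Ω φ) φ φ.contDiff x : 𝓓(Ω, ℂ)) : Euc d → ℂ) =
      fun t => τ x * φ (x - t) := by
    intro x
    ext t
    change τ x * (cutoff Ω φ t * φ (x - t)) = _
    by_cases hx : x ∈ tsupport τ
    · by_cases ht : φ (x - t) = 0
      · simp [ht]
      · rw [h1 x hx t (norm_le_radius φ ht), one_mul]
    · simp [image_eq_zero_of_notMem_tsupport hx]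
  have hFI : ∀ (k : ℕ) (I : Fin k → Fin d) (x t : Euc d),
      pderiv I (τ x • shiftMul (cutoff Ω φ) φ φ.contDiff x : 𝓓(Ω, ℂ)) t =
        (-1) ^ k * pderiv I φ (x - t) * τ x := by
    intro k I x t
    rw [hF, pderiv_const_mul (f := fun t => φ (x - t))
      (φ.contDiff.comp (contDiff_const.sub contDiff_id)), pderiv_comp_const_sub φ.contDiff]
    ring
  rw [fnPairing_regularization]
  refine (hC _ (tsupport τ) hK ?_ ?_ ?_ τ ?_ (M * radius φ ^ (p + 1 + 1) * 2)
    (by positivity) ?_).trans_lt ?_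
  · intro x hx
    rw [image_eq_zero_of_notMem_tsupport hx, zero_smul]
  · intro x t ht
    rw [hF]
    by_cases hx : x ∈ tsupport τ
    · by_cases h0 : φ (x - t) = 0
      · simp [h0]
      · refine absurd (Metric.mem_cthickening_of_dist_le t x δ _ hx ?_) ht
        rw [dist_comm, dist_eq_norm]
        exact (norm_le_radius φ h0).trans h2.le
    · simp [image_eq_zero_of_notMem_tsupport hx]
  · intro k I
    simp_rw [hFI]
    exact (continuous_const.mul ((contDiff_pderiv φ.contDiff I).continuous.comp
      (continuous_fst.sub continuous_snd))).mul (τ.continuous.comp continuous_fst)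
  · exact fun t ht => image_eq_zero_of_notMem_tsupport
      fun h => ht (Metric.self_subset_cthickening _ h)
  · intro k hk I t _
    simp_rw [hFI]
    -- All derivatives pass from φ to τ, so the growth of the derivatives of φ as R_φ tends to 0
    -- does not enter; what remains is the mollification error of `pderiv I τ`.
    rw [integral_pderiv_comp_sub_mul φ.contDiff τ.contDiff hK]
    exact h4.norm_integral_comp_sub_mul_sub_le (by omega) (contDiff_pderiv τ.contDiff I)
      (hM' k hk I) t
  · calc C * (M * radius φ ^ (p + 1 + 1) * 2)
        = C * (M * 2) * radius φ * radius φ ^ (p + 1) := by ring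
      _ ≤ (radius φ)⁻¹ * radius φ * radius φ ^ (p + 1) := by gcongr
      _ = radius φ ^ p * radius φ := by rw [inv_mul_cancel₀ hR.ne', one_mul, pow_succ]
      _ < radius φ ^ p := mul_lt_of_lt_one_right (by positivity) h3

end Association

/-! ### Change of variables -/

section ChangeOfVariables

variable {d : ℕ} {Ω' Ω : Opens (Euc d)}

/-- This is the classical substitution x = ψ⁻¹(y), made with the inverse map because its Jacobian is
the factor in `transport`. It is an exact identity for each smooth function, so it introduces no
error term into the nets. -/
lemma fnPairing_fnComp (ψ : Diffeo Ω' Ω) (f : smoothFn Ω) (τ : 𝓓(Ω', ℂ)) :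
    fnPairing τ (fnComp ψ f) = fnPairing (transport ψ τ) f := by
  have himage : ψ.invFun '' (Ω : Set (Euc d)) = Ω' := by
    ext x
    constructor
    · rintro ⟨y, hy, rfl⟩
      exact ψ.mapsTo_inv y hy
    · exact fun hx => ⟨ψ.toFun x, ψ.mapsTo x hx, ψ.left_inv x hx⟩
  have hinj : InjOn ψ.invFun (Ω : Set (Euc d)) := fun y hy z hz h => by
    rw [← ψ.right_inv y hy, h, ψ.right_inv z hz]
  have hder : ∀ y ∈ (Ω : Set (Euc d)),
      HasFDerivWithinAt ψ.invFun (fderiv ℝ ψ.invFun y) Ω y := fun y hy =>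
    ((ψ.contDiffOn_inv.contDiffAt (Ω.isOpen.mem_nhds hy)).differentiableAt
      (by simp)).hasFDerivAt.hasFDerivWithinAt
  change ∫ x in (Ω' : Set (Euc d)), fnExt (fnComp ψ f) x * τ x =
    ∫ y in (Ω : Set (Euc d)), fnExt f y * transportFn ψ τ y
  rw [← himage, integral_image_eq_integral_abs_det_fderiv_smul volume Ω.isOpen.measurableSet
    hder hinj]
  refine setIntegral_congr_fun Ω.isOpen.measurableSet fun y hy => ?_
  have h1 : fnExt (fnComp ψ f) (ψ.invFun y) = fnExt f y := by
    refine (zeroExt_comp_eqOn ψ f.1 (ψ.mapsTo_inv y hy)).trans ?_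
    rw [Function.comp_apply, ψ.right_inv y hy]
    rfl
  have h2 := transportFn_eqOn ψ τ hy
  simp only at h2 ⊢
  rw [h1, h2, jacobian, Complex.real_smul, Function.comp_apply]
  ring

end ChangeOfVariables

end AsymptoticFunctions

theorem theorem5p5 {d : ℕ} [NeZero d] (𝒰 : AsymptoticFunctions.DirectingUltrafilter d)
    (Ω Ω' : TopologicalSpace.Opens (AsymptoticFunctions.Euc d))
    (T : AsymptoticFunctions.Distr Ω) (ψ : AsymptoticFunctions.Diffeo Ω' Ω) :
    AsymptoticFunctions.WeaklyEqual
      (AsymptoticFunctions.asymComp ψ (AsymptoticFunctions.embed 𝒰 T))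
      (AsymptoticFunctions.embed 𝒰 (AsymptoticFunctions.distrComp ψ T)) := by
  intro τ
  -- The pairings of the two classes are computed on their defining nets, so equality of asymptotic
  -- numbers means that the difference of these nets is negligible.
  refine Ideal.Quotient.eq.2 (AsymptoticFunctions.negOn_iff_num.1 ?_)
  have h1 := AsymptoticFunctions.negOn_iff_num.2
    (AsymptoticFunctions.negligible_fnPairing_regularization_sub 𝒰 T
      (AsymptoticFunctions.transport ψ τ))
  have h2 := AsymptoticFunctions.negOn_iff_num.2
    (AsymptoticFunctions.negligible_fnPairing_regularization_sub 𝒰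
      (AsymptoticFunctions.distrComp ψ T) τ)
  refine (h1.add h2).mono fun φ _ _ => ?_
  change ‖AsymptoticFunctions.fnPairing τ (AsymptoticFunctions.fnComp ψ
      (AsymptoticFunctions.regularization T φ)) - AsymptoticFunctions.fnPairing τ
      (AsymptoticFunctions.regularization (AsymptoticFunctions.distrComp ψ T) φ)‖ ≤ _
  rw [AsymptoticFunctions.fnPairing_fnComp]
  -- The limits of the two nets coincide by the definition of T ∘ ψ; the triangle inequality through
  -- this common value finishes the proof.
  have h3 : AsymptoticFunctions.distrComp ψ T τ = T (AsymptoticFunctions.transport ψ τ) := rfl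
  rw [← sub_sub_sub_cancel_right _ _ (T (AsymptoticFunctions.transport ψ τ)), h3]
  exact norm_sub_le _ _
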